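/- Let $n,m\ge 0$ be integers and let $\mu,\nu,\lambda$ be partitions with $\ell(\nu)\le n$, $\ell(\mu)\le m$ and $\lambda_{n+1}<m+1$. Let $\mathcal P$ be the set of plane partitions $a=(a_{i,j})_{i,j\ge 1}$ with values in $\mathbb Z_{\ge 0}\cup\{\infty\}$ such that $a_{i,j}\ge a_{i+1,j}$, $a_{i,j}\ge a_{i,j+1}$, $a_{n+1,m+1}=0$, $\lim_{j\to\infty}a_{i,j}=\nu_i$, $\lim_{i\to\infty}a_{i,j}=\mu_j$, and $a_{i,j}=\infty$ if and only if $(i,j)\in\lambda$ (that is, $j\le\lambda_i$). For $a\in\mathcal P$ put \[|a|=\sum_{i-n\le j-m,\ (i,j)\notin\lambda}(a_{i,j}-\nu_i)+\sum_{i-n>j-m,\ (i,j)\notin\lambda}(a_{i,j}-\mu_j),\] which has only finitely many nonzero terms, and let $\chi^{n,m}_{\mu,\nu,\lambda}(q)=\sum_{a\in\mathcal P}q^{|a|}$, a formal series in $q$ (only finitely many $a$ have a given value of $|a|$). Let $r=\min\{t\ge 0:\lambda_{n-t}\ge m-t\}$, where $\lambda_0=\infty$; then $0\le r\le\min(n,m)$.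 Let $\lambda'$ be the transpose of $\lambda$, and set $\pi_i=\lambda_i-(m-r)$ for $1\le i\le n-r$, $\kappa_j=\lambda'_j-(n-r)$ for $1\le j\le m-r$, and $N_i=\nu_i+n-i$, $M_j=\mu_j+m-j$, $P_i=\pi_i+(n-r)-i$, $Q_j=\kappa_j+(m-r)-j$, $L_s=\lambda_s-s+n-m+1$ ($s\ge 1$). Let $\Theta$ be the set of triples $(\sigma,\tau,A)$ with $\sigma\in S_n$, $\tau\in S_m$ and $A=(A_1,\dots,A_r)$ such that $A_{r-i+1}=-L_{s_i}$ for $1\le i\le r$, for some integers $s_r>\cdots>s_1>n-r$ (so $A_1>\cdots>A_r\ge 0$). Then, with $(q)_\infty=\prod_{k\ge 1}(1-q^k)$ and $(-1)^{|\sigma|}$ the sign of $\sigma$, \[\chi^{n,m}_{\mu,\nu,\lambda}(q)=(-1)^{r(m+n)}\sum_{(\sigma,\tau,A)\in\Theta}(-1)^{|\sigma|+|\tau|+\sum_{i=1}^rA_i}\,\frac{q^{\Delta^{\sigma,\tau,A}(\mu,\nu,\lambda)}}{(q)_\infty^{n+m}},\] where \[\Delta^{\sigma,\tau,A}(\mu,\nu,\lambda)=\sum_{i=1}^rA_i\Bigl(\frac{A_i+1}2+N_{\sigma(i)}-M_{\tau(i)}\Bigr)-\sum_{i=r+1}^n(P_{i-r}+1)(N_{\sigma(i)}-N_{i-r})-\sum_{i=r+1}^mQ_{i-r}(M_{\tau(i)}-M_{i-r}).\]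 The sum over $\Theta$ (infinite if $r>0$) is an identity of formal Laurent series in $q$: the exponents that occur are bounded below, and each power of $q$ has a nonzero coefficient in only finitely many summands. -/

import Mathlib

open Filter Topology

open scoped PowerSeries.WithPiTopology

/-! Rows, columns and parts are indexed from `0`: the part `λ_{i+1}` of a partition is
`lam.rowLen i`, the part `λ'_{j+1}` of its transpose is `lam.colLen j`, and the entry
`a_{i+1,j+1}` of a plane partition is `a i j`. -/

namespace PitPartition

/-- Plane partitions with values in `ℕ ∪ {∞}`, with a pit in the box `(n+1, m+1)` and with
asymptotic conditions `ν` (along the rows), `μ` (down the columns) and `λ` (infinite entries). -/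
structure PlanePartition (n m : ℕ) (mu nu lam : YoungDiagram) where
  /-- the entries -/
  entry : ℕ → ℕ → ℕ∞
  /-- the entries weakly decrease down each column -/
  col_le : ∀ i j, entry (i + 1) j ≤ entry i j
  /-- the entries weakly decrease along each row -/
  row_le : ∀ i j, entry i (j + 1) ≤ entry i j
  /-- the pit -/
  pit : entry n m = 0
  /-- each row tends to the corresponding part of `ν` -/
  tendsto_row : ∀ i, Tendsto (fun j => entry i j) atTop (𝓝 (nu.rowLen i : ℕ∞))
  /-- each column tends to the corresponding part of `μ` -/
  tendsto_col : ∀ j, Tendsto (fun i => entry i j) atTop (𝓝 (mu.rowLen j : ℕ∞))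
  /-- the infinite entries are those in `λ` -/
  eq_top_iff : ∀ i j, entry i j = ⊤ ↔ (i, j) ∈ lam

variable {n m : ℕ} {mu nu lam : YoungDiagram}

/-- The contribution of one box to `|a|`: nothing for a box of `λ`; otherwise `a_{i,j} - ν_i` if
`i - n ≤ j - m` and `a_{i,j} - μ_j` if `i - n > j - m`. -/
def PlanePartition.boxWeight (a : PlanePartition n m mu nu lam) (p : ℕ × ℕ) : ℤ :=
  if p ∈ lam then 0
  else if (p.1 : ℤ) - n ≤ (p.2 : ℤ) - m then ((a.entry p.1 p.2).toNat : ℤ) - nu.rowLen p.1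
  else ((a.entry p.1 p.2).toNat : ℤ) - mu.rowLen p.2

/-- The grading `|a|`. The sum has only finitely many nonzero terms, see
`PlanePartition.finite_support_boxWeight`. -/
noncomputable def PlanePartition.weight (a : PlanePartition n m mu nu lam) : ℤ :=
  ∑ᶠ p : ℕ × ℕ, a.boxWeight p

theorem PlanePartition.finite_support_boxWeight (a : PlanePartition n m mu nu lam) :
    (Function.support a.boxWeight).Finite := by
  have hc : ∀ j, Antitone fun i => a.entry i j := fun j => antitone_nat_of_succ_le fun i => a.col_le i j
  have hr : ∀ i, Antitone fun j => a.entry i j := fun i => antitone_nat_of_succ_le fun j => a.row_le i j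
  have hnu : ∀ i j, (nu.rowLen i : ℕ∞) ≤ a.entry i j := fun i j => (hr i).le_of_tendsto (a.tendsto_row i) j
  have hmu : ∀ i j, (mu.rowLen j : ℕ∞) ≤ a.entry i j := fun i j => (hc j).le_of_tendsto (a.tendsto_col j) i
  have h1 : ∀ i, ∃ J, ∀ j, J ≤ j → a.entry i j = nu.rowLen i := fun i => by
    have h := a.tendsto_row i
    rw [ENat.nhds_natCast, tendsto_pure] at h
    exact eventually_atTop.1 h
  have h2 : ∀ j, ∃ I, ∀ i, I ≤ i → a.entry i j = mu.rowLen j := fun j => by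
    have h := a.tendsto_col j
    rw [ENat.nhds_natCast, tendsto_pure] at h
    exact eventually_atTop.1 h
  choose J hJ using h1
  choose I hI using h2
  have hz : ∀ i j, n ≤ i → m ≤ j → a.entry i j = 0 := fun i j hi hj =>
    le_antisymm (((hc j hi).trans (hr n hj)).trans a.pit.le) (zero_le)
  obtain ⟨B, hBJ, hBI, hn, hm⟩ : ∃ B, (∀ i < n, J i ≤ B) ∧ (∀ j < m, I j ≤ B) ∧ n ≤ B ∧ m ≤ B := by
    refine ⟨(∑ i ∈ Finset.range n, J i) + (∑ j ∈ Finset.range m, I j) + n + m, ?_, ?_, ?_, ?_⟩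
    · intro i hi
      have := Finset.single_le_sum (f := J) (fun _ _ => Nat.zero_le _) (Finset.mem_range.2 hi)
      omega
    · intro j hj
      have := Finset.single_le_sum (f := I) (fun _ _ => Nat.zero_le _) (Finset.mem_range.2 hj)
      omega
    · omega
    · omega
  refine (Finset.finite_toSet (Finset.range B ×ˢ Finset.range B)).subset ?_
  rintro ⟨i, j⟩ hp
  by_contra hB
  simp only [Finset.coe_product, Finset.coe_range, Set.mem_prod, Set.mem_Iio, not_and_or,
    not_lt] at hB
  apply hp
  unfold boxWeight
  by_cases hl : (i, j) ∈ lam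
  · simp [hl]
  simp only [hl, if_false]
  by_cases hi : n ≤ i
  · by_cases hj : m ≤ j
    · have h0 := hz i j hi hj
      have h3 := hnu i j
      have h4 := hmu i j
      rw [h0] at h3 h4
      have h3' : nu.rowLen i = 0 := by simpa using h3
      have h4' : mu.rowLen j = 0 := by simpa using h4
      simp [h0, h3', h4']
    · have h5 : a.entry i j = mu.rowLen j := hI j i ((hBI j (by omega)).trans (by omega))
      rw [if_neg (by omega), h5]
      simp
  · have h5 : a.entry i j = nu.rowLen i := hJ i j ((hBJ i (by omega)).trans (by omega))
    rw [if_pos (by omega), h5]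
    simp

/-- The formal power of the variable `q` with integer exponent `d`. -/
noncomputable def qpow (d : ℤ) : LaurentSeries ℚ := HahnSeries.single d 1

/-- `(q)_∞ = ∏_{k ≥ 1} (1 - q^k)`. -/
noncomputable def qInf : LaurentSeries ℚ :=
  HahnSeries.ofPowerSeries ℤ ℚ (∏' k : ℕ, (1 - PowerSeries.X ^ (k + 1)))

/-- `S` is the sum of the formal Laurent series `f i`: for each exponent only finitely many `f i`
have a nonzero coefficient, the exponents that occur are bounded below, and the coefficients of
`S` are the sums of those of the `f i`. -/
def HasFormalSum {ι : Type*} (f : ι → LaurentSeries ℚ) (S : LaurentSeries ℚ) : Prop :=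
  ∃ s : HahnSeries.SummableFamily ℤ ℚ ι, (∀ i, s i = f i) ∧ s.hsum = S

/-- The generating function `χ`: the coefficient of `q^d` is the number of plane partitions `a`
with `|a| = d`. -/
noncomputable def chi (n m : ℕ) (mu nu lam : YoungDiagram) : LaurentSeries ℚ :=
  HahnSeries.ofPowerSeries ℤ ℚ
    (PowerSeries.mk fun d => (Nat.card {a : PlanePartition n m mu nu lam // a.weight = d} : ℚ))

/-- The condition `λ_{n-t} ≥ m - t`, where `λ_0` is understood as `∞`. -/
def AtypCond (n m : ℕ) (lam : YoungDiagram) (t : ℕ) : Prop :=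
  t = n ∨ (t < n ∧ (m : ℤ) - t ≤ lam.rowLen (n - t - 1))

instance (n m : ℕ) (lam : YoungDiagram) : DecidablePred (AtypCond n m lam) := fun t => by
  unfold AtypCond; infer_instance

theorem exists_atypCond (n m : ℕ) (lam : YoungDiagram) : ∃ t, AtypCond n m lam t := ⟨n, Or.inl rfl⟩

/-- The number `r = min {t | λ_{n-t} ≥ m - t}`. -/
def atyp (n m : ℕ) (lam : YoungDiagram) : ℕ := Nat.find (exists_atypCond n m lam)

theorem atyp_le_left (n m : ℕ) (lam : YoungDiagram) : atyp n m lam ≤ n :=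
  Nat.find_min' _ (Or.inl rfl)

theorem atyp_le_right (n m : ℕ) (lam : YoungDiagram) : atyp n m lam ≤ m := by
  rcases le_or_gt n m with h | h
  · exact (atyp_le_left n m lam).trans h
  · exact Nat.find_min' _ (Or.inr ⟨h, by simp⟩)

/-- `N_{i+1} = ν_{i+1} + n - (i+1)`. -/
def N (n : ℕ) (nu : YoungDiagram) (i : ℕ) : ℤ := nu.rowLen i + n - (i + 1)

/-- `M_{j+1} = μ_{j+1} + m - (j+1)`. -/
def M (m : ℕ) (mu : YoungDiagram) (j : ℕ) : ℤ := mu.rowLen j + m - (j + 1)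

/-- `π_{i+1} = λ_{i+1} - (m - r)`, meaningful for `i < n - r`. -/
def piPart (n m : ℕ) (lam : YoungDiagram) (i : ℕ) : ℤ := lam.rowLen i - (m - atyp n m lam)

/-- `κ_{j+1} = λ'_{j+1} - (n - r)`, meaningful for `j < m - r`. -/
def kappaPart (n m : ℕ) (lam : YoungDiagram) (j : ℕ) : ℤ := lam.colLen j - (n - atyp n m lam)

/-- `P_{i+1} = π_{i+1} + (n - r) - (i+1)`. -/
def P (n m : ℕ) (lam : YoungDiagram) (i : ℕ) : ℤ :=
  piPart n m lam i + (n - atyp n m lam) - (i + 1)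

/-- `Q_{j+1} = κ_{j+1} + (m - r) - (j+1)`. -/
def Q (n m : ℕ) (lam : YoungDiagram) (j : ℕ) : ℤ :=
  kappaPart n m lam j + (m - atyp n m lam) - (j + 1)

/-- `L_{s+1} = λ_{s+1} - (s+1) + n - m + 1`. -/
def L (n m : ℕ) (lam : YoungDiagram) (s : ℕ) : ℤ := lam.rowLen s - (s + 1) + n - m + 1

/-- The index set `Θ`. The indices `s_1 < ⋯ < s_r` are `s 0 + 1 < ⋯ < s (r-1) + 1`, so that the
condition `s_i > n - r` becomes `n - r ≤ s i`. -/
structure Theta (n m : ℕ) (lam : YoungDiagram) where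
  /-- the permutation `σ ∈ S_n` -/
  sigma : Equiv.Perm (Fin n)
  /-- the permutation `τ ∈ S_m` -/
  tau : Equiv.Perm (Fin m)
  /-- the indices that determine `A` -/
  s : Fin (atyp n m lam) → ℕ
  s_strictMono : StrictMono s
  le_s : ∀ i, n - atyp n m lam ≤ s i

/-- `A_{r-i+1} = -L_{s_i}`, so that `A_1 > ⋯ > A_r ≥ 0`; here `A_{i+1}` is `θ.A i`. -/
def Theta.A (θ : Theta n m lam) (i : Fin (atyp n m lam)) : ℤ := -L n m lam (θ.s i.rev)

/-- The exponent `Δ^{σ,τ,A}(μ,ν,λ)`. The sums over `r < i ≤ n` and `r < i ≤ m` are written with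
`i = r + k + 1`, and the division by `2` is exact. -/
def Theta.Delta (θ : Theta n m lam) (mu nu : YoungDiagram) : ℤ :=
  ∑ i : Fin (atyp n m lam),
      (θ.A i * (θ.A i + 1) / 2
        + θ.A i * (N n nu (θ.sigma (i.castLE (atyp_le_left n m lam)))
          - M m mu (θ.tau (i.castLE (atyp_le_right n m lam)))))
    - ∑ k : Fin (n - atyp n m lam),
      (P n m lam k + 1)
        * (N n nu (θ.sigma ⟨atyp n m lam + k, Nat.add_lt_of_lt_sub' k.isLt⟩) - N n nu k)
    - ∑ k : Fin (m - atyp n m lam),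
      Q n m lam k
        * (M m mu (θ.tau ⟨atyp n m lam + k, Nat.add_lt_of_lt_sub' k.isLt⟩) - M m mu k)

/-- The sign `(-1)^{|σ| + |τ| + ∑ A_i}`. -/
def Theta.sign (θ : Theta n m lam) : ℚ :=
  ((Equiv.Perm.sign θ.sigma : ℤ) : ℚ) * ((Equiv.Perm.sign θ.tau : ℤ) : ℚ) * (-1) ^ (∑ i, θ.A i)

/-- The summand `(-1)^{|σ| + |τ| + ∑ A_i} q^{Δ^{σ,τ,A}(μ,ν,λ)} / (q)_∞^{n+m}`. -/
noncomputable def Theta.term (θ : Theta n m lam) (mu nu : YoungDiagram) : LaurentSeries ℚ :=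
  HahnSeries.C θ.sign * (qpow (θ.Delta mu nu) / qInf ^ (n + m))

end PitPartition

/-! Cut the plane partition along the diagonal through the box `(n, m)`. Adding the staircase `n - 1
- i` to row `i` of the upper right half turns consecutive diagonals into `n` particles with strict
one-step interlacing. Particle `i` is at infinity before time `birth i` and comes to rest at `N_i`.
The transposed lower left half gives `m` particles in the same way. The two families share only the
diagonal, where exactly `r` entries are finite, so a plane partition is a pair of paths with the
same `r` finite starting points `x_1 > ⋯ > x_r` (`halvesEquiv`, `agreeEquiv`), and the weight splits
accordingly (`PlanePartition.weight_eq`).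

For a fixed start `X`, the generating function of the paths is a power of `q` times a determinant
whose entries are, up to powers of `q`, `1/(q)_{X_i - N_k}` (`pathGF_eq_pathDet`). Both sides
satisfy the same one-step transfer equation. For the determinant, each row is summed over its own
variable; the identity `q^k/(q)_k = 1/(q)_k - 1/(q)_{k-1}` telescopes this sum to row `i`, or to row
`i` minus row `i + 1`, and such row operations preserve the determinant.

Summing the product of the two determinants over `x` is a Cauchy-Binet computation
(`hasSum_det_bordered_mul`). It replaces pairs of finite rows by the hook series `∑_x
q^{x-N}/((q)_{x-N} (q)_{x-M})`, equal to `(q)_∞^{-2} ∑_{A≥0} (-1)^A q^{A(A+1)/2 + A(N-M)}`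
(`hasSum_hook`). The same Cauchy-Binet identity read backwards (`hasSum_borderedPairing_expand`),
with the partial theta series expanded, gives a sum over `A_1 > ⋯ > A_r ≥ 0`. After the sum over
`τ`, every `A` that meets some `Q_j` drops out because a determinant has two equal rows. By the Maya
diagram of `λ` the surviving values are exactly the `-L_s` with `s > n - r` (`neg_L_ne_Q`,
`exists_neg_L_eq`), which produces `Θ`.

All sums converge in the `q`-adic topology on Laurent series, which is nonarchimedean: a family is
summable as soon as its orders tend to infinity. -/

namespace PitPartition

/-! ### The `q`-adic topology and formal sums of Laurent series. -/

section Laurent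

open WithZero LaurentSeries

/-- The additive subgroup of Laurent series all of whose exponents are at least `D`. -/
def orderGE (D : ℤ) : AddSubgroup (LaurentSeries ℚ) where
  carrier := {f | ∀ n < D, f.coeff n = 0}
  zero_mem' := fun _ _ => rfl
  add_mem' := fun {a b} ha hb n hn => by
    rw [HahnSeries.coeff_add, ha n hn, hb n hn, add_zero]
  neg_mem' := fun {a} ha n hn => by rw [HahnSeries.coeff_neg, ha n hn, neg_zero]

theorem mem_orderGE_iff_valuation {D : ℤ} {f : LaurentSeries ℚ} :
    f ∈ orderGE D ↔ Valued.v f ≤ exp (-D) :=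
  (valuation_le_iff_coeff_lt_eq_zero ℚ).symm

theorem orderGE_antitone {D E : ℤ} (h : D ≤ E) : orderGE E ≤ orderGE D :=
  fun _ hf n hn => hf n (hn.trans_le h)

theorem mul_mem_orderGE {D E : ℤ} {f g : LaurentSeries ℚ} (hf : f ∈ orderGE D)
    (hg : g ∈ orderGE E) : f * g ∈ orderGE (D + E) := by
  rw [mem_orderGE_iff_valuation] at *
  rw [map_mul, neg_add, exp_add]
  exact mul_le_mul' hf hg

theorem one_mem_orderGE : (1 : LaurentSeries ℚ) ∈ orderGE 0 := by
  rw [mem_orderGE_iff_valuation]; simp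

theorem orderGE_zero_mem_of_ofPowerSeries (f : PowerSeries ℚ) :
    HahnSeries.ofPowerSeries ℤ ℚ f ∈ orderGE 0 := by
  rw [mem_orderGE_iff_valuation]
  have := (val_le_one_iff_eq_coe ℚ (HahnSeries.ofPowerSeries ℤ ℚ f)).2 ⟨f, rfl⟩
  simpa using this

theorem hasBasis_nhds_zero_orderGE :
    (𝓝 (0 : LaurentSeries ℚ)).HasBasis (fun _ : ℤ => True)
      (fun D => (orderGE D : Set (LaurentSeries ℚ))) := by
  refine ⟨fun U => ⟨fun hU => ?_, ?_⟩⟩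
  · obtain ⟨γ, hγ⟩ := Valued.mem_nhds_zero.1 hU
    -- The shift by one makes the non-strict bound defining `orderGE` imply the strict bound of the
    -- ball of radius `γ`.
    refine ⟨-(log (MonoidWithZeroHom.ValueGroup₀.embedding γ.1) - 1), trivial, fun f hf => hγ ?_⟩
    have h1 : Valued.v f ≤ exp (log (MonoidWithZeroHom.ValueGroup₀.embedding γ.1) - 1) := by
      have := mem_orderGE_iff_valuation.1 hf
      rwa [neg_neg] at this
    have h2 : exp (log (MonoidWithZeroHom.ValueGroup₀.embedding γ.1) - 1)
        < MonoidWithZeroHom.ValueGroup₀.embedding γ.1 := by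
      rw [← lt_log_iff_exp_lt (by simp)]
      simp
    exact (Valued.v.restrict_lt_iff_lt_embedding).2 (h1.trans_lt h2)
  · rintro ⟨D, -, hD⟩
    refine Filter.mem_of_superset ?_ hD
    have h : ∀ d : ℤ, ∀ᶠ f : LaurentSeries ℚ in 𝓝 0, f.coeff d = 0 := fun d => by
      let _ : UniformSpace ℚ := ⊥
      have h1 : Continuous fun f : LaurentSeries ℚ => f.coeff d :=
        (uniformContinuous_coeff d).continuous
      have h2 := h1.tendsto 0
      have : DiscreteTopology ℚ := ⟨rfl⟩
      rw [nhds_discrete ℚ, tendsto_pure] at h2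
      simpa using h2
    obtain ⟨γ, hγ⟩ := Valued.mem_nhds_zero.1 (h (D - 1))
    -- The value group is discrete: valuation `< exp (-D + 1)` means valuation `≤ exp (-D)`.
    obtain ⟨x, hx⟩ := valuation_surjective ℚ (exp (-D + 1))
    have hx0 : Valued.v.restrict x ≠ 0 := fun h => by
      have := MonoidWithZeroHom.ValueGroup₀.restrict₀_eq_zero_iff.1 h
      rw [Valuation.coe_ofClass, hx] at this
      exact exp_ne_zero this
    refine Valued.mem_nhds_zero.2 ⟨Units.mk0 (Valued.v.restrict x) hx0, fun f hf => ?_⟩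
    have h3 : Valued.v.restrict f < Valued.v.restrict x := hf
    rw [Valued.v.restrict_lt_iff, hx] at h3
    refine mem_orderGE_iff_valuation.2 ?_
    rcases eq_or_ne (Valued.v f) 0 with h0 | h0
    · rw [h0]; exact zero_le
    · rw [← exp_log h0, exp_lt_exp] at h3
      rw [← exp_log h0, exp_le_exp]
      omega

theorem orderGE_mem_nhds (D : ℤ) : (orderGE D : Set (LaurentSeries ℚ)) ∈ 𝓝 0 :=
  hasBasis_nhds_zero_orderGE.mem_of_mem trivial

/-- This makes summability equivalent to tending to zero along the cofinite filter, and makes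
products of summable families summable. -/
instance : NonarchimedeanRing (LaurentSeries ℚ) where
  is_nonarchimedean U hU := by
    obtain ⟨D, -, hD⟩ := hasBasis_nhds_zero_orderGE.mem_iff.1 hU
    exact ⟨⟨orderGE D, AddSubgroup.isOpen_of_mem_nhds _ (orderGE_mem_nhds D)⟩, hD⟩

theorem isClosed_orderGE (D : ℤ) : IsClosed (orderGE D : Set (LaurentSeries ℚ)) :=
  AddSubgroup.isClosed_of_isOpen _ (AddSubgroup.isOpen_of_mem_nhds _ (orderGE_mem_nhds D))

theorem tendsto_zero_iff_orderGE {ι : Type*} {l : Filter ι} {f : ι → LaurentSeries ℚ} :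
    Tendsto f l (𝓝 0) ↔ ∀ D : ℤ, ∀ᶠ i in l, f i ∈ orderGE D := by
  rw [hasBasis_nhds_zero_orderGE.tendsto_right_iff]
  exact forall_congr' fun D => by simp

theorem summable_iff_orderGE {ι : Type*} {f : ι → LaurentSeries ℚ} :
    Summable f ↔ ∀ D : ℤ, {i | f i ∉ orderGE D}.Finite := by
  rw [NonarchimedeanAddGroup.summable_iff_tendsto_cofinite_zero, tendsto_zero_iff_orderGE]
  rfl

theorem tsum_mem_orderGE {ι : Type*} {f : ι → LaurentSeries ℚ} {D : ℤ} {S : LaurentSeries ℚ}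
    (hS : HasSum f S) (hf : ∀ i, f i ∈ orderGE D) : S ∈ orderGE D :=
  (isClosed_orderGE D).mem_of_tendsto hS
    (Eventually.of_forall fun _ => (orderGE D).sum_mem fun i _ => hf i)

theorem eq_zero_of_forall_mem_orderGE {f : LaurentSeries ℚ} (hf : ∀ D, f ∈ orderGE D) :
    f = 0 := by
  ext d
  exact hf (d + 1) d (by omega)

theorem HasSum.coeff_eq {ι : Type*} {f : ι → LaurentSeries ℚ} {S : LaurentSeries ℚ}
    (hS : HasSum f S) (d : ℤ) (h : {i | (f i).coeff d ≠ 0}.Finite) :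
    S.coeff d = ∑ i ∈ h.toFinset, (f i).coeff d := by
  have h1 : Tendsto (fun s : Finset ι => ∑ i ∈ s, f i - S) atTop (𝓝 0) := by
    simpa using (hS : Tendsto _ _ _).sub_const S
  have h2 := (tendsto_zero_iff_orderGE.1 h1) (d + 1)
  obtain ⟨s, hs1, hs2⟩ := (h2.and (eventually_ge_atTop h.toFinset)).exists
  have h3 := hs1 d (by omega)
  rw [HahnSeries.coeff_sub, sub_eq_zero, HahnSeries.coeff_sum] at h3
  rw [← h3]
  symm
  refine Finset.sum_subset hs2 fun i _ hi => ?_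
  simpa using hi

/-- All but finitely many members of a summable family lie in `orderGE 0`, so the exponents are
bounded below. The same argument at each level `d + 1` leaves finitely many members with a nonzero
coefficient at `d`. -/
theorem hasFormalSum_of_hasSum {ι : Type*} {f : ι → LaurentSeries ℚ} {S : LaurentSeries ℚ}
    (hS : HasSum f S) : HasFormalSum f S := by
  have hf := summable_iff_orderGE.1 hS.summable
  have hfin : ∀ d : ℤ, {i | (f i).coeff d ≠ 0}.Finite := fun d =>
    (hf (d + 1)).subset fun i hi h => hi (h d (by omega))
  have hpwo : (⋃ i, (f i).support).IsPWO := by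
    have h1 : (⋃ i, (f i).support) ⊆
        (⋃ i ∈ {i | f i ∉ orderGE 0}, (f i).support) ∪ Set.Ici 0 := by
      intro d hd
      obtain ⟨i, hi⟩ := Set.mem_iUnion.1 hd
      by_cases h0 : f i ∈ orderGE 0
      · right
        by_contra h
        exact hi (h0 d (by simpa using h))
      · left
        exact Set.mem_biUnion (show i ∈ {i | f i ∉ orderGE 0} from h0) hi
    refine Set.IsPWO.mono (Set.IsPWO.union ?_ ?_) h1
    · have : ∀ s : Set ι, s.Finite → (⋃ i ∈ s, (f i).support).IsPWO := fun s hs => by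
        induction s, hs using Set.Finite.induction_on with
        | empty => simp
        | insert _ _ ih => rw [Set.biUnion_insert]; exact (f _).isPWO_support.union ih
      exact this _ (hf 0)
    · exact Set.IsWF.isPWO (BddBelow.isWF ⟨0, fun _ h => h⟩)
  refine ⟨⟨f, hpwo, hfin⟩, fun _ => rfl, ?_⟩
  ext d
  rw [HahnSeries.SummableFamily.coeff_hsum, HasSum.coeff_eq hS d (hfin d)]
  exact finsum_eq_sum_of_support_toFinset_subset _ (hfin d) (by rfl)

theorem qpow_mem_orderGE {d D : ℤ} (h : D ≤ d) : qpow d ∈ orderGE D := fun n hn => by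
  rw [qpow, HahnSeries.coeff_single_of_ne (by omega)]

theorem qpow_add (a b : ℤ) : qpow (a + b) = qpow a * qpow b := by
  simp [qpow]

@[simp] theorem qpow_zero : qpow 0 = 1 := rfl

theorem qpow_sum {ι : Type*} (s : Finset ι) (f : ι → ℤ) :
    qpow (∑ i ∈ s, f i) = ∏ i ∈ s, qpow (f i) := by
  classical
  induction s using Finset.induction_on with
  | empty => simp
  | insert a s ha ih => rw [Finset.sum_insert ha, Finset.prod_insert ha, qpow_add, ih]

theorem qpow_ne_one {a : ℤ} (h : a ≠ 0) : qpow a ≠ 1 := fun h' => by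
  have := congrArg (fun f => f.coeff 0) h'
  simp [qpow, HahnSeries.coeff_single_of_ne (Ne.symm h)] at this

theorem summable_mul_qpow {ι : Type*} {g : ι → LaurentSeries ℚ} {e : ι → ℤ}
    (hg : ∀ i, g i ∈ orderGE 0) (he : ∀ D, {i | e i < D}.Finite) :
    Summable fun i => g i * qpow (e i) := by
  refine summable_iff_orderGE.2 fun D => (he D).subset fun i hi => ?_
  by_contra h
  simp only [Set.mem_ofPred_eq, not_lt] at h
  exact hi (by simpa using mul_mem_orderGE (hg i) (qpow_mem_orderGE h))

theorem summable_qpow {ι : Type*} {e : ι → ℤ} (he : ∀ D, {i | e i < D}.Finite) :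
    Summable fun i => qpow (e i) := by
  simpa using summable_mul_qpow (g := fun _ => 1) (fun _ => one_mem_orderGE) he

theorem finite_of_summable_qpow {ι : Type*} {e : ι → ℤ} (h : Summable fun i => qpow (e i))
    (D : ℤ) : {i | e i < D}.Finite := by
  refine (summable_iff_orderGE.1 h D).subset fun i hi hD => ?_
  have := hD (e i) hi
  simp [qpow] at this

end Laurent

end PitPartition

namespace PitPartition

/-! ### `q`-factorials, partial theta series and the hook identity. -/

section QSeries

open WithZero LaurentSeries

/-- The finite product `(q)_k = ∏_{i=1}^k (1 - q^i)`. -/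
noncomputable def qFac (k : ℕ) : LaurentSeries ℚ := ∏ i ∈ Finset.range k, (1 - qpow (i + 1))

theorem qFac_succ (k : ℕ) : qFac (k + 1) = qFac k * (1 - qpow (k + 1)) := by
  rw [qFac, Finset.prod_range_succ]; rfl

theorem valuation_qpow (d : ℤ) : Valued.v (qpow d) = exp (-d) := valuation_single_zpow ℚ d

theorem valuation_one_sub_qpow (k : ℕ) : Valued.v (1 - qpow (k + 1)) = 1 := by
  refine Valuation.map_one_sub_of_lt _ ?_
  rw [valuation_qpow, ← exp_zero, exp_lt_exp]
  omega

theorem one_sub_qpow_ne_zero (k : ℕ) : 1 - qpow (k + 1) ≠ 0 := fun h => by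
  have := valuation_one_sub_qpow k
  simp [h] at this

theorem valuation_qFac (k : ℕ) : Valued.v (qFac k) = 1 := by
  induction k with
  | zero => simp [qFac]
  | succ k ih => rw [qFac_succ, map_mul, ih, valuation_one_sub_qpow, mul_one]

theorem qFac_ne_zero (k : ℕ) : qFac k ≠ 0 := fun h => by
  have := valuation_qFac k
  simp [h] at this

theorem inv_qFac_mem_orderGE (k : ℕ) : (qFac k)⁻¹ ∈ orderGE 0 := by
  rw [mem_orderGE_iff_valuation, map_inv₀, valuation_qFac]; simp

theorem qFac_eq_ofPowerSeries (k : ℕ) :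
    qFac k = HahnSeries.ofPowerSeries ℤ ℚ
      (∏ i ∈ Finset.range k, (1 - PowerSeries.X ^ (i + 1))) := by
  rw [map_prod, qFac]
  refine Finset.prod_congr rfl fun i _ => ?_
  rw [map_sub, map_one, HahnSeries.ofPowerSeries_X_pow, qpow]
  push_cast
  rfl

theorem coeff_prod_one_sub_X_pow_of_lt {d k : ℕ} (h : d < k) :
    PowerSeries.coeff d (∏ i ∈ Finset.range k, (1 - PowerSeries.X ^ (i + 1) : PowerSeries ℚ))
      = PowerSeries.coeff d
        (∏ i ∈ Finset.range (d + 1), (1 - PowerSeries.X ^ (i + 1) : PowerSeries ℚ)) := by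
  induction k, (show d + 1 ≤ k from h) using Nat.le_induction with
  | base => rfl
  | succ k hk ih =>
    rw [Finset.prod_range_succ, mul_sub, mul_one, map_sub, ih (by omega), sub_eq_self,
      PowerSeries.coeff_mul_X_pow', if_neg (by omega)]

theorem coeff_tprod_one_sub_X_pow {d k : ℕ} (h : d < k) :
    PowerSeries.coeff d (∏' k : ℕ, (1 - PowerSeries.X ^ (k + 1) : PowerSeries ℚ))
      = PowerSeries.coeff d
        (∏ i ∈ Finset.range k, (1 - PowerSeries.X ^ (i + 1) : PowerSeries ℚ)) := by
  have h1 := (PowerSeries.WithPiTopology.multipliable_one_sub_X_pow ℚ).hasProd.tendsto_prod_nat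
  have h2 := ((PowerSeries.WithPiTopology.continuous_coeff ℚ d).tendsto _).comp h1
  refine tendsto_nhds_unique h2 (tendsto_const_nhds.congr' ?_)
  filter_upwards [eventually_gt_atTop d] with j hj
  rw [Function.comp_apply, coeff_prod_one_sub_X_pow_of_lt h, coeff_prod_one_sub_X_pow_of_lt hj]

theorem tendsto_qFac : Tendsto qFac atTop (𝓝 qInf) := by
  rw [← tendsto_sub_nhds_zero_iff, tendsto_zero_iff_orderGE]
  intro D
  filter_upwards [eventually_ge_atTop D.toNat] with k hk n hn
  rw [qFac_eq_ofPowerSeries, qInf, ← map_sub]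
  rcases lt_or_ge n 0 with h0 | h0
  · exact orderGE_zero_mem_of_ofPowerSeries _ n h0
  · lift n to ℕ using h0
    rw [HahnSeries.ofPowerSeries_apply_coeff, map_sub, sub_eq_zero]
    exact (coeff_tprod_one_sub_X_pow (by omega)).symm

theorem qInf_ne_zero : qInf ≠ 0 := fun h => by
  have := PowerSeries.WithPiTopology.tprod_one_sub_X_pow_ne_zero ℚ
  rw [qInf, map_eq_zero_iff _ HahnSeries.ofPowerSeries_injective] at h
  exact this h

theorem tendsto_inv_qFac : Tendsto (fun k => (qFac k)⁻¹) atTop (𝓝 qInf⁻¹) :=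
  tendsto_qFac.inv₀ qInf_ne_zero

theorem inv_qInf_mem_orderGE : qInf⁻¹ ∈ orderGE 0 :=
  (isClosed_orderGE 0).mem_of_tendsto tendsto_inv_qFac
    (Eventually.of_forall inv_qFac_mem_orderGE)

/-- `1 / (q)_{x - N}`, understood as `0` if `x < N`. -/
noncomputable def invFac (x N : ℕ) : LaurentSeries ℚ := if x < N then 0 else (qFac (x - N))⁻¹

/-- `1 / (q)_{x - N}`, understood as `0` if `x < N` and as `1 / (q)_∞` if `x = ∞`. -/
noncomputable def invFacTop (x : ℕ∞) (N : ℕ) : LaurentSeries ℚ :=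
  if x = ⊤ then qInf⁻¹ else invFac x.toNat N

@[simp] theorem invFacTop_top (N : ℕ) : invFacTop ⊤ N = qInf⁻¹ := if_pos rfl

@[simp] theorem invFacTop_coe (x N : ℕ) : invFacTop x N = invFac x N := by
  simp [invFacTop]

theorem invFac_mem_orderGE (x N : ℕ) : invFac x N ∈ orderGE 0 := by
  unfold invFac
  split_ifs
  exacts [zero_mem _, inv_qFac_mem_orderGE _]

theorem invFac_succ_succ (x N : ℕ) : invFac (x + 1) (N + 1) = invFac x N := by
  simp [invFac]

theorem invFac_zero_succ (N : ℕ) : invFac 0 (N + 1) = 0 := by simp [invFac]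

theorem invFac_self (N : ℕ) : invFac N N = 1 := by simp [invFac, qFac]

theorem invFac_of_lt {x N : ℕ} (h : x < N) : invFac x N = 0 := if_pos h

theorem tendsto_invFac (N : ℕ) : Tendsto (fun x => invFac x N) atTop (𝓝 qInf⁻¹) := by
  have h := tendsto_inv_qFac.comp (tendsto_sub_atTop_nat N)
  refine h.congr' ?_
  filter_upwards [eventually_ge_atTop N] with x hx
  simp [invFac, not_lt.2 hx]

theorem qpow_mul_invFac_zero (N : ℕ) : qpow (((0 : ℕ) : ℤ) - N) * invFac 0 N = invFac 0 N := by
  cases N with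
  | zero => simp
  | succ N => simp [invFac]

/-- This is `q^k/(q)_k = 1/(q)_k - 1/(q)_{k-1}`. The convention that `1/(q)_k = 0` for `k < 0` makes
it valid for every `x`. All later telescoping rests on it. -/
theorem qpow_mul_invFac_succ (x N : ℕ) :
    qpow (((x + 1 : ℕ) : ℤ) - N) * invFac (x + 1) N = invFac (x + 1) N - invFac x N := by
  rcases lt_trichotomy (x + 1) N with h | h | h
  · rw [invFac_of_lt h, invFac_of_lt (by omega : x < N)]; simp
  · rw [← h, invFac_self, invFac_of_lt (by omega : x < x + 1)]; simp
  · obtain ⟨k, rfl⟩ : ∃ k, x = N + k := ⟨x - N, by omega⟩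
    have h1 : invFac (N + k + 1) N = (qFac (k + 1))⁻¹ := by
      rw [invFac, if_neg (by omega)]; congr 2; omega
    have h2 : invFac (N + k) N = (qFac k)⁻¹ := by
      rw [invFac, if_neg (by omega)]; congr 2; omega
    have h3 : ((N + k + 1 : ℕ) : ℤ) - N = k + 1 := by push_cast; ring
    rw [h1, h2, h3, qFac_succ]
    have := qFac_ne_zero k
    have := one_sub_qpow_ne_zero k
    field_simp
    ring

theorem sum_range_qpow_mul_invFac (x N : ℕ) :
    ∑ y ∈ Finset.range (x + 1), qpow ((y : ℤ) - N) * invFac y N = invFac x N := by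
  induction x with
  | zero => simpa using qpow_mul_invFac_zero N
  | succ x ih => rw [Finset.sum_range_succ, ih, qpow_mul_invFac_succ]; ring

theorem finite_natCast_sub_lt (N : ℕ) (D : ℤ) : {x : ℕ | (x : ℤ) - N < D}.Finite :=
  (Set.finite_Iio (D + N).toNat).subset fun x hx => by
    simp only [Set.mem_ofPred_eq, Set.mem_Iio] at *
    omega

theorem hasSum_qpow_mul_invFac (N : ℕ) :
    HasSum (fun y : ℕ => qpow ((y : ℤ) - N) * invFac y N) qInf⁻¹ := by
  have h : Summable (fun y : ℕ => qpow ((y : ℤ) - N) * invFac y N) := by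
    simpa [mul_comm] using summable_mul_qpow (fun y => invFac_mem_orderGE y N)
      (finite_natCast_sub_lt N)
  have h1 := h.hasSum.tendsto_sum_nat.comp (tendsto_add_atTop_nat 1)
  have h2 : Tendsto (fun x => invFac x N) atTop (𝓝 (∑' y : ℕ, qpow ((y : ℤ) - N) * invFac y N)) :=
    h1.congr fun x => sum_range_qpow_mul_invFac x N
  rw [← tendsto_nhds_unique h2 (tendsto_invFac N)]
  exact h.hasSum

theorem hasSum_le_qpow_mul_invFac (X : ℕ∞) (N : ℕ) :
    HasSum (fun y : ℕ => if (y : ℕ∞) ≤ X then qpow ((y : ℤ) - N) * invFac y N else 0)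
      (invFacTop X N) := by
  induction X using ENat.recTopCoe with
  | top => simpa using hasSum_qpow_mul_invFac N
  | coe x =>
    rw [invFacTop_coe, ← sum_range_qpow_mul_invFac]
    have h := hasSum_sum_of_ne_finset_zero (L := .unconditional ℕ) (s := Finset.range (x + 1))
      (f := fun y : ℕ => if (y : ℕ∞) ≤ x then qpow ((y : ℤ) - N) * invFac y N else 0)
      (fun y hy => if_neg (by simpa using hy))
    convert h using 1
    refine Finset.sum_congr rfl fun y hy => ?_
    rw [if_pos (by simpa [Nat.lt_succ_iff] using hy)]

/-- The bound `lo ≤ X + 1` places every `y < lo` below or at `X`, so the sum over the interval is a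
difference of two initial sums. The case `lo = X + 1` is the empty interval. -/
theorem hasSum_Ico_qpow_mul_invFac {X : ℕ∞} {lo : ℕ} (h : (lo : ℕ∞) ≤ X + 1) (N : ℕ) :
    HasSum (fun y : ℕ∞ => if y ≤ X ∧ lo ≤ y ∧ y ≠ ⊤ then qpow ((y.toNat : ℤ) - N) * invFacTop y N
      else 0) (invFacTop X N - ∑ y ∈ Finset.range lo, qpow ((y : ℤ) - N) * invFac y N) := by
  have h0 : Function.Injective ((↑) : ℕ → ℕ∞) := Nat.cast_injective
  rw [← h0.hasSum_iff]
  · have h1 := hasSum_sum_of_ne_finset_zero (L := .unconditional ℕ) (s := Finset.range lo)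
      (f := fun y : ℕ => if y < lo then qpow ((y : ℤ) - N) * invFac y N else 0)
      (fun y hy => if_neg (by simpa using hy))
    have h2 := (hasSum_le_qpow_mul_invFac X N).sub h1
    rw [Finset.sum_congr rfl fun y hy => if_pos (Finset.mem_range.1 hy)] at h2
    refine (congrArg (fun f => HasSum f _) (funext fun y => ?_)).mpr h2
    simp only [Function.comp_apply, Nat.cast_le, ENat.natCast_ne_top, ne_eq, not_false_eq_true,
      and_true, ENat.toNat_natCast, invFacTop_coe]
    by_cases hy : y < lo
    · have h3 : (y : ℕ∞) ≤ X := by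
        have : ((y + 1 : ℕ) : ℕ∞) ≤ X + 1 := le_trans (by exact_mod_cast hy) h
        push_cast at this
        exact (ENat.add_le_add_iff_right (by simp)).1 this
      simp [hy, h3]
    · simp [hy, not_lt.1 hy]
  · intro y hy
    have : y = ⊤ := by
      by_contra h
      exact hy ⟨y.toNat, ENat.natCast_toNat h⟩
    simp [this]

theorem summable_hook (N M : ℕ) :
    Summable fun x : ℕ => qpow ((x : ℤ) - N) * invFac x N * invFac x M := by
  have h := summable_mul_qpow (fun x => by
    simpa using mul_mem_orderGE (invFac_mem_orderGE x N) (invFac_mem_orderGE x M))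
    (finite_natCast_sub_lt N)
  refine h.congr fun x => ?_
  ring

/-- A discrete Leibniz rule. With `u_x = 1/(q)_{x-N}` and `v_x = 1/(q)_{x-M}`, the two summands are
`(u_x - u_{x-1}) v_x` and `u_{x-1} (v_x - v_{x-1})`, so the partial sums telescope to `u_x v_x`. -/
theorem hook_recursion (N M : ℕ) :
    (∑' x : ℕ, qpow ((x : ℤ) - N) * invFac x N * invFac x M)
      + qpow ((N : ℤ) - M + 1) *
        (∑' x : ℕ, qpow ((x : ℤ) - (N + 1 : ℕ)) * invFac x (N + 1) * invFac x M)
      = qInf⁻¹ * qInf⁻¹ := by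
  have h := (summable_hook N M).hasSum.add
    ((summable_hook (N + 1) M).hasSum.mul_left (qpow ((N : ℤ) - M + 1)))
  have h1 := h.tendsto_sum_nat.comp (tendsto_add_atTop_nat 1)
  refine tendsto_nhds_unique h1 (((tendsto_invFac N).mul (tendsto_invFac M)).congr fun k => ?_)
  rw [Function.comp_apply]
  induction k with
  | zero =>
    rw [Finset.sum_range_one, qpow_mul_invFac_zero, invFac_zero_succ]
    ring
  | succ k ih =>
    rw [Finset.sum_range_succ, ← ih, qpow_mul_invFac_succ, invFac_succ_succ]
    have h2 := qpow_mul_invFac_succ k M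
    have h3 : qpow (((k + 1 : ℕ) : ℤ) - M)
        = qpow ((N : ℤ) - M + 1) * qpow (((k + 1 : ℕ) : ℤ) - (N + 1 : ℕ)) := by
      rw [← qpow_add]; congr 1; push_cast; ring
    rw [h3] at h2
    linear_combination (-invFac k N) * h2

/-- Completing the square gives a lower bound linear in `A`, so only finitely many theta exponents
lie below a given level. -/
theorem sub_sq_le_quadratic (A d : ℤ) : A - (2 * d - 1) ^ 2 ≤ A * (A + 1) / 2 + A * d := by
  have h : 2 * (A * (A + 1) / 2) = A * (A + 1) :=
    Int.mul_ediv_cancel' (Int.even_mul_succ_self A).two_dvd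
  nlinarith [sq_nonneg (2 * A + (2 * d - 1)), sq_nonneg (2 * d - 1)]

theorem neg_one_zpow_mem_orderGE (k : ℤ) : ((-1) ^ k : LaurentSeries ℚ) ∈ orderGE 0 := by
  rcases Int.even_or_odd k with h | h
  · rw [h.neg_one_zpow]; exact one_mem_orderGE
  · rw [h.neg_one_zpow]; exact neg_mem one_mem_orderGE

theorem summable_theta (d : ℤ) :
    Summable fun A : ℕ => (-1) ^ (A : ℤ) * qpow ((A : ℤ) * (A + 1) / 2 + A * d) := by
  refine summable_mul_qpow (fun A => neg_one_zpow_mem_orderGE A) fun D => ?_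
  refine (Set.finite_Iio (D + (2 * d - 1) ^ 2).toNat).subset fun A hA => ?_
  have := sub_sq_le_quadratic A d
  simp only [Set.mem_ofPred_eq, Set.mem_Iio] at *
  omega

theorem theta_recursion (d : ℤ) :
    ∑' A : ℕ, (-1) ^ (A : ℤ) * qpow ((A : ℤ) * (A + 1) / 2 + A * d)
      = 1 - qpow (d + 1) *
        ∑' A : ℕ, (-1) ^ (A : ℤ) * qpow ((A : ℤ) * (A + 1) / 2 + A * (d + 1)) := by
  rw [(summable_theta d).tsum_eq_zero_add, ← tsum_mul_left, sub_eq_add_neg, ← tsum_neg]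
  congr 1
  · simp
  · refine tsum_congr fun A => ?_
    have h : (((A + 1 : ℕ) : ℤ) * (((A + 1 : ℕ) : ℤ) + 1) / 2 + ((A + 1 : ℕ) : ℤ) * d)
        = (d + 1) + ((A : ℤ) * (A + 1) / 2 + A * (d + 1)) := by
      have : (((A + 1 : ℕ) : ℤ) * (((A + 1 : ℕ) : ℤ) + 1)) = (A : ℤ) * (A + 1) + (A + 1) * 2 := by
        push_cast; ring
      rw [this, Int.add_mul_ediv_right _ _ (by norm_num)]
      push_cast
      ring
    rw [h, qpow_add]
    push_cast
    rw [zpow_add₀ (by norm_num)]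
    ring

/-- The generating function of a hook: the case `n = m = 1` of the bosonic formula. -/
theorem hasSum_hook (N M : ℕ) :
    HasSum (fun x : ℕ => qpow ((x : ℤ) - N) * invFac x N * invFac x M)
      ((∑' A : ℕ, (-1) ^ (A : ℤ) * qpow ((A : ℤ) * (A + 1) / 2 + A * ((N : ℤ) - M)))
        * (qInf⁻¹ * qInf⁻¹)) := by
  suffices h : ∀ N : ℕ, (∑' x : ℕ, qpow ((x : ℤ) - N) * invFac x N * invFac x M)
      - (∑' A : ℕ, (-1) ^ (A : ℤ) * qpow ((A : ℤ) * (A + 1) / 2 + A * ((N : ℤ) - M)))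
        * (qInf⁻¹ * qInf⁻¹) = 0 by
    rw [← sub_eq_zero.1 (h N)]
    exact (summable_hook N M).hasSum
  set δ : ℕ → LaurentSeries ℚ := fun N =>
    (∑' x : ℕ, qpow ((x : ℤ) - N) * invFac x N * invFac x M)
      - (∑' A : ℕ, (-1) ^ (A : ℤ) * qpow ((A : ℤ) * (A + 1) / 2 + A * ((N : ℤ) - M)))
        * (qInf⁻¹ * qInf⁻¹) with hδ
  -- The hook series and the theta expression obey the same inhomogeneous recursion in `N`, so their
  -- difference obeys the homogeneous one.
  have hrec : ∀ N, δ N = -(qpow ((N : ℤ) - M + 1) * δ (N + 1)) := fun N => by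
    have h1 := hook_recursion N M
    have h2 := theta_recursion ((N : ℤ) - M)
    have h3 : ((N + 1 : ℕ) : ℤ) - M = (N : ℤ) - M + 1 := by push_cast; ring
    simp only [hδ, h3]
    linear_combination h1 - h2 * (qInf⁻¹ * qInf⁻¹)
  -- For `N ≥ M` the factor `q^{N-M+1}` has order at least one, so each use of the recursion
  -- improves the bound by one, and `δ N = 0` in the limit. The recursion then carries the vanishing
  -- down to `N < M`.
  have hmem : ∀ k : ℕ, ∀ N, M ≤ N → δ N ∈ orderGE k := fun k => by
    induction k with
    | zero =>
      intro N hN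
      refine sub_mem ?_ ?_
      · refine tsum_mem_orderGE (summable_hook N M).hasSum fun x => ?_
        rcases lt_or_ge x N with h | h
        · rw [invFac_of_lt h]; simp
        · have := mul_mem_orderGE (mul_mem_orderGE (qpow_mem_orderGE (D := 0) (by omega :
            (0 : ℤ) ≤ (x : ℤ) - N)) (invFac_mem_orderGE x N)) (invFac_mem_orderGE x M)
          simpa using this
      · have h1 : (∑' A : ℕ, (-1) ^ (A : ℤ) * qpow ((A : ℤ) * (A + 1) / 2 + A * ((N : ℤ) - M)))
            ∈ orderGE 0 := by
          refine tsum_mem_orderGE (summable_theta _).hasSum fun A => ?_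
          have : (0 : ℤ) ≤ (A : ℤ) * (A + 1) / 2 + A * ((N : ℤ) - M) := by
            have : (0 : ℤ) ≤ (N : ℤ) - M := by omega
            positivity
          simpa using mul_mem_orderGE (neg_one_zpow_mem_orderGE A) (qpow_mem_orderGE this)
        simpa using mul_mem_orderGE h1 (mul_mem_orderGE inv_qInf_mem_orderGE inv_qInf_mem_orderGE)
    | succ k ih =>
      intro N hN
      rw [hrec]
      refine neg_mem (orderGE_antitone ?_
        (mul_mem_orderGE (qpow_mem_orderGE le_rfl) (ih (N + 1) (by omega))))
      push_cast
      omega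
  have hzero : ∀ N, M ≤ N → δ N = 0 := fun N hN => eq_zero_of_forall_mem_orderGE fun D =>
    orderGE_antitone (Int.self_le_toNat D) (hmem D.toNat N hN)
  have hdown : ∀ k N, M ≤ N + k → δ N = 0 := fun k => by
    induction k with
    | zero => exact fun N hN => hzero N hN
    | succ k ih => exact fun N hN => by rw [hrec, ih (N + 1) (by omega)]; simp
  exact fun N => hdown M N (by omega)

end QSeries

end PitPartition

namespace PitPartition

/-! ### Sums of products, of determinants and over decreasing tuples. -/

section Sums

theorem hasSum_pi_prod {r : ℕ} {β : Type*} {f : Fin r → β → LaurentSeries ℚ}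
    {s : Fin r → LaurentSeries ℚ} (h : ∀ i, HasSum (f i) (s i)) :
    HasSum (fun x : Fin r → β => ∏ i, f i (x i)) (∏ i, s i) := by
  induction r with
  | zero => simp
  | succ r ih =>
    rw [Fin.prod_univ_succ, ← (Fin.consEquiv fun _ => β).hasSum_iff]
    have h1 := (h 0).mul_of_nonarchimedean (ih fun i => h i.succ)
    refine (congrArg (fun f => HasSum f _) (funext fun y => ?_)).mpr h1
    simp [Fin.prod_univ_succ, Fin.consEquiv]

theorem det_eq_sum_sign {n : ℕ} (A : Matrix (Fin n) (Fin n) (LaurentSeries ℚ)) :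
    A.det = ∑ σ : Equiv.Perm (Fin n), ((Equiv.Perm.sign σ : ℤ) : LaurentSeries ℚ)
      * ∏ i, A i (σ i) := by
  rw [← Matrix.det_transpose, Matrix.det_apply']
  rfl

/-- Row `i` depends only on the variable `Y i`, so by multilinearity the sum over `Y` can be taken
row by row. -/
theorem hasSum_det {n : ℕ} {β : Type*} {f : Fin n → β → Fin n → LaurentSeries ℚ}
    {s : Fin n → Fin n → LaurentSeries ℚ} (h : ∀ i k, HasSum (fun y => f i y k) (s i k)) :
    HasSum (fun Y : Fin n → β => (Matrix.of fun i k => f i (Y i) k).det) (Matrix.of s).det := by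
  simp only [det_eq_sum_sign, Matrix.of_apply]
  exact hasSum_sum fun σ _ => (hasSum_pi_prod fun i => h i (σ i)).mul_left _

theorem strictAnti_eq_of_comp_eq {r : ℕ} {x y : Fin r → ℕ} (hx : StrictAnti x)
    (hy : StrictAnti y) {ρ ρ' : Equiv.Perm (Fin r)} (h : x ∘ ρ = y ∘ ρ') : x = y := by
  have h1 : Set.range (x ∘ Fin.rev) = Set.range (y ∘ Fin.rev) := by
    rw [Fin.rev_surjective.range_comp, Fin.rev_surjective.range_comp,
      ← ρ.surjective.range_comp x, ← ρ'.surjective.range_comp y, h]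
  have h2 := (StrictMono.range_inj (hx.comp Fin.rev_strictAnti)
    (hy.comp Fin.rev_strictAnti)).1 h1
  funext i
  simpa using congrFun h2 i.rev

theorem exists_strictAnti_comp {r : ℕ} {x : Fin r → ℕ} (hx : Function.Injective x) :
    ∃ (y : Fin r → ℕ) (ρ : Equiv.Perm (Fin r)), StrictAnti y ∧ y ∘ ρ = x := by
  refine ⟨x ∘ Tuple.sort x ∘ Fin.rev, ((Fin.revPerm).trans (Tuple.sort x)).symm, ?_, ?_⟩
  · have h := (Tuple.monotone_sort x).strictMono_of_injective
      (hx.comp (Tuple.sort x).injective)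
    exact h.comp_strictAnti Fin.rev_strictAnti
  · funext i
    simp

/-- A summable symmetric function on tuples that vanishes on tuples with a repeated entry is
determined by its values on strictly decreasing tuples. -/
theorem hasSum_strictAnti {r : ℕ} {T : (Fin r → ℕ) → LaurentSeries ℚ} {S : LaurentSeries ℚ}
    (hsymm : ∀ (x : Fin r → ℕ) (ρ : Equiv.Perm (Fin r)), T (x ∘ ρ) = T x)
    (hinj : ∀ x, ¬ Function.Injective x → T x = 0) (hT : HasSum T S) :
    HasSum (fun x : {x : Fin r → ℕ // StrictAnti x} => T x)
      ((r.factorial : LaurentSeries ℚ)⁻¹ * S) := by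
  have h1 : HasSum (fun x : {x : Fin r → ℕ | Function.Injective x} => T x) S :=
    (hasSum_subtype_iff_of_support_subset fun x hx => by
      by_contra h
      exact hx (hinj x h)).2 hT
  -- An injective tuple is, in exactly one way, a rearrangement of a strictly decreasing one. By
  -- symmetry each decreasing tuple is therefore counted `r!` times.
  let e : {x : Fin r → ℕ // StrictAnti x} × Equiv.Perm (Fin r) ≃
      {x : Fin r → ℕ | Function.Injective x} :=
    Equiv.ofBijective (fun p => ⟨p.1.1 ∘ p.2, p.1.2.injective.comp p.2.injective⟩) (by
      constructor
      · rintro ⟨⟨x, hx⟩, ρ⟩ ⟨⟨y, hy⟩, ρ'⟩ h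
        have h' : x ∘ ρ = y ∘ ρ' := congrArg Subtype.val h
        obtain rfl := strictAnti_eq_of_comp_eq hx hy h'
        have : ρ = ρ' := Equiv.ext fun i => hx.injective (congrFun h' i)
        rw [this]
      · rintro ⟨x, hx⟩
        obtain ⟨y, ρ, hy, h⟩ := exists_strictAnti_comp hx
        exact ⟨(⟨y, hy⟩, ρ), Subtype.ext h⟩)
  have h2 := e.hasSum_iff.2 h1
  have h3 : HasSum (fun p : {x : Fin r → ℕ // StrictAnti x} × Equiv.Perm (Fin r) => T p.1) S := by
    refine (congrArg (fun f => HasSum f _) (funext fun p => ?_)).mpr h2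
    exact (hsymm _ _).symm
  have h4 : HasSum (fun x : {x : Fin r → ℕ // StrictAnti x} =>
      (r.factorial : LaurentSeries ℚ) * T x) S := h3.prod_fiberwise fun x => by
    have := hasSum_fintype (fun _ : Equiv.Perm (Fin r) => T x.1)
    simpa [Fintype.card_perm] using this
  have h5 := h4.mul_left (r.factorial : LaurentSeries ℚ)⁻¹
  have h6 : (r.factorial : LaurentSeries ℚ) ≠ 0 := by
    rw [← map_natCast (HahnSeries.C : ℚ →+* LaurentSeries ℚ)]
    exact (map_ne_zero_iff _ HahnSeries.C_injective).2 (by exact_mod_cast r.factorial_ne_zero)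
  refine (congrArg (fun f => HasSum f _) (funext fun x => ?_)).mpr h5
  rw [inv_mul_cancel_left₀ h6]

end Sums

end PitPartition

namespace PitPartition

/-! ### Interlacing particles and the determinantal formula. -/

section Paths

variable {n : ℕ}

/-- A family of `n` particles on a half line with interlacing one-step transitions: particle `i` is
at infinity before the time `b i` and eventually at rest at the point `N i`. -/
structure IsPath (b N : Fin n → ℕ) (c : ℕ → Fin n → ℕ∞) : Prop where
  top_iff : ∀ t i, c t i = ⊤ ↔ t < b i
  anti : ∀ t i, c (t + 1) i ≤ c t i
  interlace : ∀ t (i j : Fin n), (j : ℕ) = i + 1 → c t j + 1 ≤ c (t + 1) i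
  eventually_eq : ∀ i, ∀ᶠ t in atTop, c t i = N i

namespace IsPath

variable {b N : Fin n → ℕ} {c : ℕ → Fin n → ℕ∞}

theorem antitone (h : IsPath b N c) (i : Fin n) : Antitone fun t => c t i :=
  antitone_nat_of_succ_le fun t => h.anti t i

theorem le (h : IsPath b N c) (t : ℕ) (i : Fin n) : (N i : ℕ∞) ≤ c t i := by
  obtain ⟨s, hs, hst⟩ := ((h.eventually_eq i).and (eventually_ge_atTop t)).exists
  rw [← hs]
  exact h.antitone i hst

theorem tail (h : IsPath b N c) : IsPath (fun i => b i - 1) N fun t => c (t + 1) where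
  top_iff t i := by rw [h.top_iff]; omega
  anti t i := h.anti (t + 1) i
  interlace t i j hij := h.interlace (t + 1) i j hij
  eventually_eq i := (tendsto_add_atTop_nat 1).eventually (h.eventually_eq i)

theorem exists_forall_eq (h : IsPath b N c) : ∃ T, ∀ t, T ≤ t → ∀ i, c t i = N i :=
  eventually_atTop.1 (eventually_all.2 h.eventually_eq)

theorem cons (h : IsPath (fun i => b i - 1) N c) {X : Fin n → ℕ∞} (hX : ∀ i, X i = ⊤ ↔ 0 < b i)
    (h1 : ∀ i, c 0 i ≤ X i) (h2 : ∀ i j : Fin n, (j : ℕ) = i + 1 → X j + 1 ≤ c 0 i) :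
    IsPath b N fun t => Nat.casesOn t X c where
  top_iff t i := by
    cases t with
    | zero => exact hX i
    | succ t => refine (h.top_iff t i).trans ?_; omega
  anti t i := by
    cases t with
    | zero => exact h1 i
    | succ t => exact h.anti t i
  interlace t i j hij := by
    cases t with
    | zero => exact h2 i j hij
    | succ t => exact h.interlace t i j hij
  eventually_eq i := by
    rw [← map_add_atTop_eq_nat 1, eventually_map]
    exact h.eventually_eq i

end IsPath

/-- The excess of the position of a particle over its final position, `0` for a particle at
infinity. -/
def excess (N : Fin n → ℕ) (Y : Fin n → ℕ∞) : ℕ := ∑ i, ((Y i).toNat - N i)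

/-- The total excess at all times `t ≥ 1`. -/
noncomputable def pathWeight (N : Fin n → ℕ) (c : ℕ → Fin n → ℕ∞) : ℕ :=
  ∑ᶠ t, excess N (c (t + 1))

theorem finsum_excess_eq_sum {N : Fin n → ℕ} {c : ℕ → Fin n → ℕ∞} {T : ℕ}
    (h : ∀ t, T ≤ t → ∀ i, c t i = N i) : ∑ᶠ t, excess N (c t)
      = ∑ t ∈ Finset.range T, excess N (c t) := by
  refine finsum_eq_sum_of_support_subset _ fun t ht => ?_
  by_contra hT
  refine ht (Finset.sum_eq_zero fun i _ => ?_)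
  rw [h t (by simpa using hT)]
  simp

theorem finsum_excess_eq_add {b N : Fin n → ℕ} {c : ℕ → Fin n → ℕ∞} (h : IsPath b N c) :
    ∑ᶠ t, excess N (c t) = excess N (c 0) + pathWeight N c := by
  obtain ⟨T, hT⟩ := h.exists_forall_eq
  rw [pathWeight, finsum_excess_eq_sum (T := T + 1) fun t ht => hT t (by omega),
    finsum_excess_eq_sum (c := fun t => c (t + 1)) (T := T) fun t ht => hT (t + 1) (by omega),
    Finset.sum_range_succ', add_comm]

theorem pathWeight_eq_add {b N : Fin n → ℕ} {c : ℕ → Fin n → ℕ∞} (h : IsPath b N c) :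
    pathWeight N c = excess N (c 1) + pathWeight N (fun t => c (t + 1)) :=
  finsum_excess_eq_add h.tail

/-- The paths with given birth times and final positions. -/
abbrev Path (b N : Fin n → ℕ) := {c : ℕ → Fin n → ℕ∞ // IsPath b N c}

/-- A finite position exceeds its limit by at most `D`. A particle not yet at rest at time `t` has
excess at least one at each time from its birth to `t`, so all particles rest from time `∑ b i + D`
on. Finitely many initial segments remain. -/
theorem Path.finite_setOf_finsum_excess_le (b N : Fin n → ℕ) (D : ℕ) :
    {p : Path b N | ∑ᶠ t, excess N (p.1 t) ≤ D}.Finite := by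
  have key : ∀ p : Path b N, ∑ᶠ t, excess N (p.1 t) ≤ D → ∀ s : Finset ℕ, ∀ i,
      ∑ t ∈ s, ((p.1 t i).toNat - N i) ≤ D := fun p hp s i => by
    obtain ⟨T, hT⟩ := p.2.exists_forall_eq
    rw [finsum_excess_eq_sum (T := T + s.sup id + 1) fun t ht => hT t (by omega)] at hp
    refine le_trans ?_ hp
    refine (Finset.sum_le_sum fun t _ => Finset.single_le_sum
      (f := fun i => (p.1 t i).toNat - N i) (fun _ _ => Nat.zero_le _) (Finset.mem_univ i)).trans ?_
    refine Finset.sum_le_sum_of_subset fun t ht => ?_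
    have : t ≤ s.sup id := Finset.le_sup (f := id) ht
    simp only [Finset.mem_range]
    omega
  have hfin : ∀ p : Path b N, ∑ᶠ t, excess N (p.1 t) ≤ D → ∀ t i, (∑ i, b i) + D ≤ t →
      p.1 t i = N i := fun p hp t i ht => by
    by_contra hne
    have hb : b i ≤ ∑ i, b i := Finset.single_le_sum (f := b) (fun _ _ => Nat.zero_le _)
      (Finset.mem_univ i)
    have h1 : ∀ s ∈ Finset.Icc (b i) t, 1 ≤ (p.1 s i).toNat - N i := fun s hs => by
      rw [Finset.mem_Icc] at hs
      have h2 : (N i : ℕ∞) < p.1 s i :=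
        (lt_of_le_of_ne (p.2.le t i) (Ne.symm hne)).trans_le (p.2.antitone i hs.2)
      have h3 : p.1 s i ≠ ⊤ := fun h => by
        have := (p.2.top_iff s i).1 h
        omega
      lift p.1 s i to ℕ using h3 with x
      have : N i < x := by exact_mod_cast h2
      simp only [ENat.toNat_natCast]
      omega
    have h4 := (Finset.card_nsmul_le_sum _ _ _ h1).trans (key p hp _ i)
    rw [Nat.card_Icc] at h4
    simp only [smul_eq_mul, mul_one] at h4
    omega
  let S : Fin ((∑ i, b i) + D) → Set (Fin n → ℕ∞) := fun _ =>
    Set.univ.pi fun i => insert ⊤ ((↑) '' Set.Iic (N i + D))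
  have hS : (Set.univ.pi S).Finite := Set.Finite.pi fun _ => Set.Finite.pi fun i =>
    ((Set.finite_Iic _).image _).insert _
  refine Set.Finite.of_finite_image (f := fun p : Path b N =>
    fun t : Fin ((∑ i, b i) + D) => p.1 t) (hS.subset ?_) ?_
  · rintro _ ⟨p, hp, rfl⟩
    refine fun t _ i _ => ?_
    by_cases h : p.1 t i = ⊤
    · exact Or.inl h
    · right
      have := key p hp {(t : ℕ)} i
      rw [Finset.sum_singleton] at this
      refine ⟨(p.1 t i).toNat, ?_, ENat.natCast_toNat h⟩
      simp only [Set.mem_Iic]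
      omega
  · intro p hp p' hp' h
    refine Subtype.ext (funext fun t => funext fun i => ?_)
    rcases lt_or_ge t ((∑ i, b i) + D) with ht | ht
    · exact congrFun (congrFun h ⟨t, ht⟩) i
    · rw [hfin p hp t i ht, hfin p' hp' t i ht]

theorem Path.summable_start (b N : Fin n → ℕ) (X : Fin n → ℕ∞) :
    Summable fun p : {p : Path b N // p.1 0 = X} => qpow (pathWeight N p.1.1) := by
  refine summable_qpow fun D => ?_
  refine Set.Finite.of_finite_image (f := Subtype.val)
    ((Path.finite_setOf_finsum_excess_le b N (excess N X + D.toNat)).subset ?_)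
    Subtype.val_injective.injOn
  rintro _ ⟨p, hp, rfl⟩
  simp only [Set.mem_ofPred_eq] at hp ⊢
  rw [finsum_excess_eq_add p.1.2, p.2]
  omega

/-- The generating function of the paths that start at `X`. -/
noncomputable def pathGF (b N : Fin n → ℕ) (X : Fin n → ℕ∞) : LaurentSeries ℚ :=
  ∑' p : {p : Path b N // p.1 0 = X}, qpow (pathWeight N p.1.1)

theorem pathGF_eq_zero {b N : Fin n → ℕ} {X : Fin n → ℕ∞}
    (h : ∀ c, IsPath b N c → c 0 ≠ X) : pathGF b N X = 0 := by
  have : IsEmpty {p : Path b N // p.1 0 = X} := ⟨fun p => h p.1.1 p.1.2 p.2⟩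
  exact tsum_empty

/-- The excess as an integer, without truncation. -/
noncomputable def excessInt (N : Fin n → ℕ) (Y : Fin n → ℕ∞) : ℤ :=
  ∑ i, if Y i = ⊤ then 0 else ((Y i).toNat : ℤ) - N i

theorem excessInt_eq {N : Fin n → ℕ} {Y : Fin n → ℕ∞} (h : ∀ i, (N i : ℕ∞) ≤ Y i) :
    excessInt N Y = excess N Y := by
  unfold excessInt excess
  push_cast
  refine Finset.sum_congr rfl fun i _ => ?_
  by_cases ht : Y i = ⊤
  · simp [ht]
  · have h1 := h i
    rw [if_neg ht]
    lift Y i to ℕ using ht with y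
    rw [ENat.toNat_natCast]
    have : N i ≤ y := by exact_mod_cast h1
    omega

/-- The possible positions of particle `i` one step after the state `X`. -/
def StepAt (b : Fin n → ℕ) (X : Fin n → ℕ∞) (i : Fin n) (y : ℕ∞) : Prop :=
  y ≤ X i ∧ (∀ j : Fin n, (j : ℕ) = i + 1 → X j + 1 ≤ y) ∧ (y = ⊤ ↔ 1 < b i)

-- The transfer equation: paths are sorted by their state at time one, and the tail of a path is a
-- path with all birth times lowered by one.
open Classical in
theorem hasSum_pathGF {b N : Fin n → ℕ} {X : Fin n → ℕ∞} (hX : ∀ i, X i = ⊤ ↔ 0 < b i) :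
    HasSum (fun Y : Fin n → ℕ∞ => if ∀ i, StepAt b X i (Y i) then
      qpow (excessInt N Y) * pathGF (fun i => b i - 1) N Y else 0) (pathGF b N X) := by
  have h := (Path.summable_start b N X).hasSum.tsum_fiberwise fun p => p.1.1 1
  refine (congrArg (fun f => HasSum f _) (funext fun Y => ?_)).mpr h
  split_ifs with hY
  · let e : {p : Path (fun i => b i - 1) N // p.1 0 = Y} ≃
        (fun p : {p : Path b N // p.1 0 = X} => p.1.1 1) ⁻¹' {Y} :=
      { toFun := fun p => ⟨⟨⟨_, p.1.2.cons hX (fun i => by rw [p.2]; exact (hY i).1)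
          (fun i j hij => by rw [p.2]; exact (hY i).2.1 j hij)⟩, rfl⟩, p.2⟩
        invFun := fun p => ⟨⟨_, p.1.1.2.tail⟩, p.2⟩
        left_inv := fun p => rfl
        right_inv := fun p => by
          refine Subtype.ext (Subtype.ext (Subtype.ext (funext fun t => ?_)))
          cases t with
          | zero => exact p.1.2.symm
          | succ t => rfl }
    rw [pathGF, ← tsum_mul_left, ← e.tsum_eq]
    refine tsum_congr fun p => ?_
    have h1 := pathWeight_eq_add (e p).1.1.2
    have h2 : (e p).1.1.1 1 = Y := p.2
    rw [h1, h2, Nat.cast_add, qpow_add, excessInt_eq fun i => by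
      rw [← p.2]; exact p.1.2.le 0 i]
    rfl
  · symm
    have : IsEmpty ((fun p : {p : Path b N // p.1 0 = X} => p.1.1 1) ⁻¹' {Y}) := ⟨fun p => by
      refine hY fun i => ?_
      have h1 : p.1.1.1 1 = Y := p.2
      have h2 := p.1.2
      have h3 : StepAt b (p.1.1.1 0) i (p.1.1.1 1 i) :=
        ⟨p.1.1.2.anti 0 i, fun j hj => p.1.1.2.interlace 0 i j hj, p.1.1.2.top_iff 1 i⟩
      rwa [h1, h2] at h3⟩
    exact tsum_empty

/-- The matrix whose determinant is, up to a power of `q`, the generating function of paths. -/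
noncomputable def pathMatrix (b N : Fin n → ℕ) (X : Fin n → ℕ∞) :
    Matrix (Fin n) (Fin n) (LaurentSeries ℚ) :=
  Matrix.of fun i k => qpow (-((b i - 1 : ℕ) : ℤ) * N k) * invFacTop (X i) (N k)

/-- The determinantal formula for the generating function of paths. -/
noncomputable def pathDet (b N : Fin n → ℕ) (X : Fin n → ℕ∞) : LaurentSeries ℚ :=
  qpow (∑ i, ((b i - 1 : ℕ) : ℤ) * N i) * (pathMatrix b N X).det

/-- Reversing the order of rows and columns turns the next row into the previous one, which is the
standard form of this row operation. -/
theorem det_eq_of_row_eq_add_succ {R : Type*} [CommRing R] {A B : Matrix (Fin n) (Fin n) R}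
    (c : Fin n → R) (hlast : ∀ i : Fin n, (i : ℕ) + 1 = n → ∀ k, A i k = B i k)
    (h : ∀ i j : Fin n, (j : ℕ) = i + 1 → ∀ k, A i k = B i k + c i * A j k) :
    A.det = B.det := by
  cases n with
  | zero => simp
  | succ n =>
    rw [← Matrix.det_submatrix_equiv_self Fin.revPerm A,
      ← Matrix.det_submatrix_equiv_self Fin.revPerm B]
    refine Matrix.det_eq_of_forall_row_eq_smul_add_pred (fun i => c i.succ.rev) ?_ ?_
    · intro k
      exact hlast _ (by simp) _
    · intro i k
      exact h _ _ (by simp [Fin.rev]; omega) _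

/-- The contribution of a particle that moves to `y` to a row of the matrix. -/
noncomputable def stepRow (b N : Fin n → ℕ) (i : Fin n) (y : ℕ∞) (k : Fin n) : LaurentSeries ℚ :=
  if y = ⊤ then qpow (-((b i - 1 : ℕ) : ℤ) * N k) * qInf⁻¹
  else qpow ((y.toNat : ℤ) - N k) * invFacTop y (N k)

/-- The weight of the new state is absorbed by scaling column `k` by `q^{-N_k}` and each finite row
by `q^{Y_i}`. For a particle still at infinity, the column factor restores the exponent `b i - 1`
from `b i - 2`. -/
theorem excessInt_mul_pathDet {b N : Fin n → ℕ} {X Y : Fin n → ℕ∞}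
    (hY : ∀ i, StepAt b X i (Y i)) :
    qpow (excessInt N Y) * pathDet (fun i => b i - 1) N Y
      = qpow (∑ i, ((b i - 1 : ℕ) : ℤ) * N i)
        * (Matrix.of fun i k => stepRow b N i (Y i) k).det := by
  have h1 : (Matrix.of fun i k => stepRow b N i (Y i) k)
      = Matrix.of fun i k => qpow (if Y i = ⊤ then 0 else (Y i).toNat)
        * (Matrix.of fun i k => qpow (-(N k : ℤ)) * pathMatrix (fun i => b i - 1) N Y i k) i k := by
    ext1 i k
    have h2 := (hY i).2.2
    simp only [Matrix.of_apply, stepRow, pathMatrix]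
    split_ifs with h
    · have h3 := h2.1 h
      rw [h, invFacTop_top, qpow_zero, one_mul, ← mul_assoc, ← qpow_add]
      congr 2
      have : ((b i - 1 : ℕ) : ℤ) = ((b i - 1 - 1 : ℕ) : ℤ) + 1 := by omega
      rw [this]
      ring
    · have h3 : b i ≤ 1 := not_lt.1 fun h' => h (h2.2 h')
      rw [← mul_assoc, ← mul_assoc, ← qpow_add, ← qpow_add]
      congr 2
      have : ((b i - 1 - 1 : ℕ) : ℤ) = 0 := by omega
      rw [this]
      ring
  rw [h1, Matrix.det_mul_column, Matrix.det_mul_row, pathDet, ← qpow_sum, ← qpow_sum,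
    ← mul_assoc, ← mul_assoc, ← mul_assoc, ← qpow_add, ← qpow_add, ← qpow_add]
  congr 2
  rw [excessInt, ← Finset.sum_add_distrib, ← Finset.sum_add_distrib, ← Finset.sum_add_distrib]
  refine Finset.sum_congr rfl fun i _ => ?_
  have h2 := (hY i).2.2
  split_ifs with h
  · have h3 := h2.1 h
    have : ((b i - 1 : ℕ) : ℤ) = ((b i - 1 - 1 : ℕ) : ℤ) + 1 := by omega
    rw [this]
    ring
  · have h3 : b i ≤ 1 := not_lt.1 fun h' => h (h2.2 h')
    have h4 : ((b i - 1 : ℕ) : ℤ) = 0 := by omega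
    have h5 : ((b i - 1 - 1 : ℕ) : ℤ) = 0 := by omega
    rw [h4, h5]
    ring

-- If `b i > 1`, the particle can only stay at infinity and its row is unchanged. Otherwise it moves
-- to a finite `y` with `X_{i+1} < y ≤ X_i`, and the telescoping sum is row `i` minus row `i + 1`.
-- Strict decrease of the positive birth times forces `b (i + 1) = 0` there, so `X_{i+1}` is finite
-- and row `i + 1` carries no power of `q`. For the last particle there is no lower bound and
-- nothing is subtracted.
open Classical in
theorem hasSum_stepRow {b N : Fin n → ℕ} {X : Fin n → ℕ∞} (hX : ∀ i, X i = ⊤ ↔ 0 < b i)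
    (hdec : ∀ i j : Fin n, (j : ℕ) = i + 1 → X j + 1 ≤ X i)
    (hb : ∀ i j : Fin n, (j : ℕ) = i + 1 → 0 < b j → b j < b i) (i k : Fin n) :
    HasSum (fun y => if StepAt b X i y then stepRow b N i y k else 0)
      (pathMatrix b N X i k - if h : (i : ℕ) + 1 < n then
        (if 1 < b i then 0 else 1) * pathMatrix b N X ⟨i + 1, h⟩ k else 0) := by
  by_cases hi : 1 < b i
  · have htop : X i = ⊤ := (hX i).2 (by omega)
    have h := hasSum_single (f := fun y => if StepAt b X i y then stepRow b N i y k else 0) ⊤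
      (fun y hy => if_neg fun h => hy (h.2.2.2 hi))
    have hst : StepAt b X i ⊤ := ⟨by rw [htop], fun j _ => le_top, by simp [hi]⟩
    rw [if_pos hst] at h
    simpa [hi, stepRow, pathMatrix, htop] using h
  · have hi0 : ((b i - 1 : ℕ) : ℤ) = 0 := by omega
    have hrow : pathMatrix b N X i k = invFacTop (X i) (N k) := by
      simp [pathMatrix, hi0]
    have hterm : ∀ lo : ℕ, (∀ y, (∀ j : Fin n, (j : ℕ) = i + 1 → X j + 1 ≤ y) ↔ (lo : ℕ∞) ≤ y) →
        (fun y => if StepAt b X i y then stepRow b N i y k else 0)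
        = fun y : ℕ∞ => if y ≤ X i ∧ lo ≤ y ∧ y ≠ ⊤ then qpow ((y.toNat : ℤ) - N k)
          * invFacTop y (N k) else 0 := fun lo hlo => by
      funext y
      have : StepAt b X i y ↔ y ≤ X i ∧ lo ≤ y ∧ y ≠ ⊤ := by
        unfold StepAt
        rw [hlo]
        simp [hi]
      by_cases h : StepAt b X i y
      · rw [if_pos h, if_pos (this.1 h), stepRow, if_neg (this.1 h).2.2]
      · rw [if_neg h, if_neg fun h' => h (this.2 h')]
    by_cases hn : (i : ℕ) + 1 < n
    · have hj0 : b ⟨i + 1, hn⟩ = 0 := by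
        by_contra h
        have := hb i ⟨i + 1, hn⟩ rfl (Nat.pos_of_ne_zero h)
        omega
      have hj : X ⟨i + 1, hn⟩ ≠ ⊤ := fun h => by
        have := (hX _).1 h
        omega
      obtain ⟨x, hx⟩ := ENat.ne_top_iff_exists.1 hj
      rw [hterm (x + 1)]
      · have h := hasSum_Ico_qpow_mul_invFac (X := X i) (lo := x + 1)
          (by
            have := hdec i ⟨i + 1, hn⟩ rfl
            rw [← hx] at this
            push_cast
            exact this.trans le_self_add) (N k)
        rw [sum_range_qpow_mul_invFac] at h
        convert h using 1
        rw [hrow, dif_pos hn, if_neg hi]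
        simp [pathMatrix, hj0, ← hx]
      · intro y
        push_cast
        rw [hx]
        refine ⟨fun h => h _ rfl, fun h j hj => ?_⟩
        have : j = ⟨i + 1, hn⟩ := Fin.ext hj
        rwa [this]
    · rw [hterm 0]
      · have h := hasSum_Ico_qpow_mul_invFac (X := X i) (lo := 0) (by simp) (N k)
        convert h using 1
        rw [hrow, dif_neg hn]
        simp
      · intro y
        refine ⟨fun _ => by simp, fun _ j hj => ?_⟩
        have := j.2
        omega

-- The determinant satisfies the transfer equation of `pathGF`: summing the rows independently only
-- performs row operations.
open Classical in
theorem hasSum_pathDet {b N : Fin n → ℕ} {X : Fin n → ℕ∞} (hX : ∀ i, X i = ⊤ ↔ 0 < b i)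
    (hdec : ∀ i j : Fin n, (j : ℕ) = i + 1 → X j + 1 ≤ X i)
    (hb : ∀ i j : Fin n, (j : ℕ) = i + 1 → 0 < b j → b j < b i) :
    HasSum (fun Y : Fin n → ℕ∞ => if ∀ i, StepAt b X i (Y i) then
      qpow (excessInt N Y) * pathDet (fun i => b i - 1) N Y else 0) (pathDet b N X) := by
  have h := (hasSum_det fun i k => hasSum_stepRow hX hdec hb (N := N) i k).mul_left
    (qpow (∑ i, ((b i - 1 : ℕ) : ℤ) * N i))
  have hdet : (pathMatrix b N X).det = (Matrix.of fun i k : Fin n =>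
      pathMatrix b N X i k - if h : (i : ℕ) + 1 < n then
        (if 1 < b i then 0 else 1) * pathMatrix b N X ⟨i + 1, h⟩ k else 0).det := by
    refine det_eq_of_row_eq_add_succ (fun i => if 1 < b i then 0 else 1) ?_ ?_
    · intro i hi k
      rw [Matrix.of_apply, dif_neg (by omega), sub_zero]
    · intro i j hij k
      have hn : (i : ℕ) + 1 < n := hij ▸ j.2
      have : j = ⟨i + 1, hn⟩ := Fin.ext hij
      rw [Matrix.of_apply, dif_pos hn, this, sub_add_cancel]
  rw [pathDet, hdet]
  refine (congrArg (fun f => HasSum f _) (funext fun Y => ?_)).mpr h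
  split_ifs with hY
  · rw [excessInt_mul_pathDet hY]
    congr 3
    funext i k
    rw [if_pos (hY i)]
  · push Not at hY
    obtain ⟨i, hi⟩ := hY
    rw [Matrix.det_eq_zero_of_row_eq_zero i, mul_zero]
    intro k
    rw [Matrix.of_apply, if_neg hi]

theorem pathGF_eq_pathDet_of_agree {b N : Fin n → ℕ} {X : Fin n → ℕ∞}
    (hX : ∀ i, X i = ⊤ ↔ 0 < b i)
    (hdec : ∀ i j : Fin n, (j : ℕ) = i + 1 → X j + 1 ≤ X i)
    (hb : ∀ i j : Fin n, (j : ℕ) = i + 1 → 0 < b j → b j < b i)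
    (h : ∀ Y, (∀ i, Y i ≤ X i) → (∀ i, Y i = ⊤ ↔ 0 < b i - 1) →
      (∀ i j : Fin n, (j : ℕ) = i + 1 → Y j + 1 ≤ Y i) →
      pathGF (fun i => b i - 1) N Y = pathDet (fun i => b i - 1) N Y) :
    pathGF b N X = pathDet b N X := by
  classical
  refine (hasSum_pathGF hX).unique ?_
  refine (congrArg (fun f => HasSum f _) (funext fun Y => ?_)).mpr (hasSum_pathDet hX hdec hb)
  split_ifs with hY
  · rw [h Y (fun i => (hY i).1) (fun i => by rw [(hY i).2.2]; omega) fun i j hij =>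
      (add_le_add_left (hY j).1 1).trans ((hY i).2.1 j hij)]
  · rfl

/-- Pigeonhole: `σ` cannot map the indices `≥ i` into the strictly fewer indices `> i`. -/
theorem exists_le_apply_le (σ : Equiv.Perm (Fin n)) (i : Fin n) : ∃ j, i ≤ j ∧ σ j ≤ i := by
  by_contra h
  push Not at h
  have h1 : (Finset.Ici i).map σ.toEmbedding ⊆ Finset.Ioi i := fun k hk => by
    obtain ⟨j, hj, rfl⟩ := Finset.mem_map.1 hk
    exact Finset.mem_Ioi.2 (h j (Finset.mem_Ici.1 hj))
  have h2 := Finset.card_le_card h1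
  rw [Finset.card_map, Fin.card_Ici, Fin.card_Ioi] at h2
  omega

theorem antitone_of_succ_le {X : Fin n → ℕ∞}
    (hdec : ∀ i j : Fin n, (j : ℕ) = i + 1 → X j + 1 ≤ X i) : Antitone X := by
  cases n with
  | zero => exact fun i => i.elim0
  | succ n =>
    exact Fin.antitone_iff_succ_le.2 fun i => le_self_add.trans (hdec i.castSucc i.succ (by simp))

/-- The entries in rows `≥ i` and columns `≤ i` all vanish, since there `X_j ≤ X_i < N_i ≤ N_k`.
Every permutation meets this block. -/
theorem pathDet_eq_zero {N : Fin n → ℕ} (hN : StrictAnti N) {X : Fin n → ℕ∞}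
    (hX : Antitone X) {i : Fin n} (hi : X i < N i) : pathDet 0 N X = 0 := by
  suffices h : (pathMatrix 0 N X).det = 0 by rw [pathDet, h, mul_zero]
  rw [det_eq_sum_sign]
  refine Finset.sum_eq_zero fun σ _ => ?_
  obtain ⟨j, hij, hj⟩ := exists_le_apply_le σ i
  rw [Finset.prod_eq_zero (Finset.mem_univ j), mul_zero]
  have h1 : X j < N (σ j) :=
    (hX hij).trans_lt (hi.trans_le (by exact_mod_cast hN.antitone hj))
  have h2 : X j ≠ ⊤ := ne_top_of_lt h1
  obtain ⟨x, hx⟩ := ENat.ne_top_iff_exists.1 h2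
  rw [← hx] at h1
  rw [pathMatrix, Matrix.of_apply, ← hx, invFacTop_coe, invFac_of_lt (by exact_mod_cast h1),
    mul_zero]

theorem pathDet_self {N : Fin n → ℕ} (hN : StrictAnti N) :
    pathDet 0 N (fun i => N i) = 1 := by
  have h : (pathMatrix 0 N fun i => (N i : ℕ∞)).BlockTriangular id := fun i k hik => by
    rw [pathMatrix, Matrix.of_apply, invFacTop_coe, invFac_of_lt (hN (show k < i from hik)),
      mul_zero]
  rw [pathDet, Matrix.det_of_isUpperTriangular h]
  simp [pathMatrix, invFac_self]

theorem pathGF_self {N : Fin n → ℕ} (hN : StrictAnti N) :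
    pathGF 0 N (fun i => N i) = 1 := by
  have hc : IsPath 0 N fun _ i => (N i : ℕ∞) :=
    ⟨fun t i => by simp, fun t i => le_rfl, fun t i j hij => by
      have : N j + 1 ≤ N i := hN (by rw [Fin.lt_def]; omega)
      exact_mod_cast this, fun i => Eventually.of_forall fun _ => rfl⟩
  have huniq : ∀ p : {p : Path 0 N // p.1 0 = fun i => (N i : ℕ∞)},
      p = ⟨⟨fun _ i => (N i : ℕ∞), hc⟩, rfl⟩ := fun p => by
    refine Subtype.ext (Subtype.ext (funext fun t => funext fun i => le_antisymm ?_ ?_))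
    · exact (p.1.2.antitone i (Nat.zero_le t)).trans (congrFun p.2 i).le
    · exact p.1.2.le t i
  rw [pathGF, tsum_eq_single ⟨⟨fun _ i => (N i : ℕ∞), hc⟩, rfl⟩ fun p hp => absurd (huniq p) hp]
  simp [pathWeight, excess]

/-- With all particles finite, the transfer equation involves `X` itself and states of smaller total
position. By induction the difference of the two sides is fixed by multiplication with `q^{excessInt
N X}`, hence zero unless this exponent is zero. If every `N i ≤ X i`, exponent zero forces `X = N`,
where both sides are `1`; if some `X i < N i`, both sides are `0`. -/
theorem pathGF_zero_eq_pathDet {N : Fin n → ℕ} (hN : StrictAnti N) (s : ℕ) (X : Fin n → ℕ∞)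
    (hs : ∑ i, (X i).toNat ≤ s) (hX : ∀ i, X i ≠ ⊤)
    (hdec : ∀ i j : Fin n, (j : ℕ) = i + 1 → X j + 1 ≤ X i) :
    pathGF 0 N X = pathDet 0 N X := by
  classical
  induction s using Nat.strong_induction_on generalizing X with
  | _ s ih =>
    have hX' : ∀ i : Fin n, X i = ⊤ ↔ 0 < (0 : Fin n → ℕ) i := fun i => by simp [hX i]
    have h := (hasSum_pathGF hX' (N := N)).sub (hasSum_pathDet hX' hdec (by simp) (N := N))
    have h0 : (fun i : Fin n => (0 : Fin n → ℕ) i - 1) = 0 := rfl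
    simp only [h0] at h
    have hstep : ∀ i, StepAt 0 X i (X i) := fun i => ⟨le_rfl, hdec i, by simp [hX i]⟩
    -- A step to `Y ≠ X` strictly lowers the total position, so the induction hypothesis cancels
    -- every term except `Y = X`.
    have h1 := h.unique (hasSum_single X fun Y hY => by
      split_ifs with hst
      · have hlt : ∑ i, (Y i).toNat < ∑ i, (X i).toNat := by
          obtain ⟨i, hi⟩ := Function.ne_iff.1 hY
          refine Finset.sum_lt_sum (fun i _ => ENat.toNat_le_toNat (hst i).1 (hX i))
            ⟨i, Finset.mem_univ i, ?_⟩
          have h2 := lt_of_le_of_ne (hst i).1 hi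
          have h3 : Y i ≠ ⊤ := ne_top_of_lt h2
          have h4 := hX i
          lift Y i to ℕ using h3 with y
          lift X i to ℕ using h4 with x
          simpa using h2
        rw [ih _ (lt_of_lt_of_le hlt hs) Y le_rfl
          (fun i h => by have := ((hst i).2.2).1 h; simp at this)
          fun i j hij => (add_le_add_left (hst j).1 1).trans ((hst i).2.1 j hij), sub_self]
      · simp)
    rw [if_pos hstep, if_pos hstep, ← mul_sub] at h1
    by_cases hle : ∀ i, (N i : ℕ∞) ≤ X i
    · by_cases he : excessInt N X = 0
      · have hXN : X = fun i => (N i : ℕ∞) := by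
          rw [excessInt_eq hle] at he
          have he' : excess N X = 0 := by exact_mod_cast he
          rw [excess, Finset.sum_eq_zero_iff] at he'
          funext i
          have h2 := he' i (Finset.mem_univ i)
          have h3 := hle i
          have h4 := hX i
          lift X i to ℕ using h4 with x
          rw [ENat.toNat_natCast] at h2
          have h5 : N i ≤ x := by exact_mod_cast h3
          have : x = N i := by omega
          rw [this]
        rw [hXN, pathGF_self hN, pathDet_self hN]
      · have h2 : (1 - qpow (excessInt N X)) * (pathGF 0 N X - pathDet 0 N X) = 0 := by
          linear_combination h1
        rcases mul_eq_zero.1 h2 with h3 | h3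
        · exact absurd (sub_eq_zero.1 h3).symm (qpow_ne_one he)
        · exact sub_eq_zero.1 h3
    · push Not at hle
      obtain ⟨i, hi⟩ := hle
      rw [pathDet_eq_zero hN (antitone_of_succ_le hdec) hi, pathGF_eq_zero]
      rintro c hc rfl
      exact absurd (hc.le 0 i) (not_le.2 hi)

/-- The determinantal formula for the generating function of paths. -/
theorem pathGF_eq_pathDet {b N : Fin n → ℕ} (hN : StrictAnti N) {X : Fin n → ℕ∞}
    (hX : ∀ i, X i = ⊤ ↔ 0 < b i)
    (hdec : ∀ i j : Fin n, (j : ℕ) = i + 1 → X j + 1 ≤ X i)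
    (hb : ∀ i j : Fin n, (j : ℕ) = i + 1 → 0 < b j → b j < b i) :
    pathGF b N X = pathDet b N X := by
  obtain ⟨B, hB⟩ : ∃ B, ∀ i, b i ≤ B :=
    ⟨∑ i, b i, fun i => Finset.single_le_sum (fun _ _ => Nat.zero_le _) (Finset.mem_univ i)⟩
  -- Each step lowers all birth times by one, until every particle is finite.
  induction B generalizing b X with
  | zero =>
    obtain rfl : b = 0 := funext fun i => Nat.le_zero.1 (hB i)
    exact pathGF_zero_eq_pathDet hN _ X le_rfl (fun i h => by simpa using (hX i).1 h) hdec
  | succ B ih =>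
    refine pathGF_eq_pathDet_of_agree hX hdec hb fun Y _ hY hYdec => ih hY hYdec ?_ ?_
    · intro i j hij hj
      have := hb i j hij (by omega)
      omega
    · intro i
      have := hB i
      omega

end Paths

end PitPartition

namespace PitPartition

/-! ### Translation between halves of a plane partition and paths. -/

section Halves

/-- The half of a plane partition with `n` nontrivial rows that lies weakly above the diagonal
through `(n, m)`, as a family of `n` particles. -/
def halfPath (n m : ℕ) (a : ℕ → ℕ → ℕ∞) (t : ℕ) (i : Fin n) : ℕ∞ :=
  if i + m + t < n then ⊤ else a i (i + m + t - n) + ((n - 1 - i : ℕ) : ℕ∞)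

/-- The times at which the rows become finite. -/
def birth (n m : ℕ) (len : ℕ → ℕ) (i : Fin n) : ℕ := len i + n - (m + i)

/-- The shifted parts `part i + n - (i + 1)` of a partition. -/
def shiftedPart (n : ℕ) (part : ℕ → ℕ) (i : Fin n) : ℕ := part i + (n - 1 - i)

variable {n m : ℕ} {a : ℕ → ℕ → ℕ∞} {len part : ℕ → ℕ}

/-- Row monotonicity is monotonicity in time. The entry of row `i + 1` at time `t` lies directly
below that of row `i` at time `t + 1`, so column monotonicity is interlacing, made strict by the
staircase shift. -/
theorem isPath_halfPath (hcol : ∀ i j, a (i + 1) j ≤ a i j) (hrow : ∀ i j, a i (j + 1) ≤ a i j)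
    (htop : ∀ i j, a i j = ⊤ ↔ j < len i)
    (hlim : ∀ i, Tendsto (fun j => a i j) atTop (𝓝 (part i : ℕ∞))) :
    IsPath (birth n m len) (shiftedPart n part) (halfPath n m a) where
  top_iff t i := by
    unfold halfPath birth
    split_ifs with h
    · simp only [true_iff]; omega
    · rw [ENat.add_eq_top, htop]
      simp only [ENat.natCast_ne_top, or_false]
      omega
  anti t i := by
    unfold halfPath
    split_ifs with h1 h2 h2
    · exact le_rfl
    · omega
    · exact le_top
    · rw [show (i : ℕ) + m + (t + 1) - n = i + m + t - n + 1 by omega]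
      exact add_le_add_left (hrow _ _) _
  interlace t i j hij := by
    unfold halfPath
    have hj := j.2
    split_ifs with h1 h2 h2
    · exact le_top
    · omega
    · omega
    · rw [show (j : ℕ) + m + t - n = i + m + (t + 1) - n by omega,
        show n - 1 - (i : ℕ) = n - 1 - j + 1 by omega, Nat.cast_add, Nat.cast_one, ← add_assoc, hij]
      rw [← add_assoc]
      exact add_le_add_left (add_le_add_left (hcol _ _) _) _
  eventually_eq i := by
    have h := hlim i
    rw [ENat.nhds_natCast, tendsto_pure] at h
    obtain ⟨J, hJ⟩ := eventually_atTop.1 h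
    filter_upwards [eventually_ge_atTop (J + n)] with t ht
    rw [halfPath, if_neg (by omega), hJ _ (by omega), shiftedPart]
    push_cast
    rfl

/-- Change of variables from boxes to pairs of time and row. Positions left of the first column
contribute zero because `toNat ⊤ = 0`. With `d = 0` the common diagonal is included, with `d = 1` it
is not. -/
theorem finsum_halfPath (n m : ℕ) (a : ℕ → ℕ → ℕ∞) (part : ℕ → ℕ) (d : ℕ) :
    ∑ᶠ q : ℕ × ℕ, (if q.1 < n ∧ q.1 + m + d ≤ q.2 + n then (a q.1 q.2).toNat - part q.1 else 0)
      = ∑ᶠ x : ℕ × Fin n, ((halfPath n m a (x.1 + d) x.2).toNat - shiftedPart n part x.2) := by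
  rw [← finsum_mem_support, ← finsum_mem_support (f := fun x : ℕ × Fin n => _)]
  symm
  have key : ∀ (t : ℕ) (i : Fin n), n ≤ i + m + (t + d) →
      (halfPath n m a (t + d) i).toNat - shiftedPart n part i
        = (a i (i + m + (t + d) - n)).toNat - part i := fun t i h => by
    rw [halfPath, if_neg (by omega), shiftedPart]
    by_cases h' : a i (i + m + (t + d) - n) = ⊤
    · simp [h']
    · rw [ENat.toNat_add h' (by simp), ENat.toNat_natCast]
      omega
  have hne : ∀ (t : ℕ) (i : Fin n),
      (halfPath n m a (t + d) i).toNat - shiftedPart n part i ≠ 0 → n ≤ i + m + (t + d) :=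
    fun t i h => by
      by_contra h'
      rw [halfPath, if_pos (by omega)] at h
      simp at h
  have hval : ∀ x ∈ Function.support (fun x : ℕ × Fin n =>
      (halfPath n m a (x.1 + d) x.2).toNat - shiftedPart n part x.2),
      (halfPath n m a (x.1 + d) x.2).toNat - shiftedPart n part x.2 =
      if (x.2 : ℕ) < n ∧ (x.2 : ℕ) + m + d ≤ (x.2 + m + (x.1 + d) - n) + n then
        (a x.2 (x.2 + m + (x.1 + d) - n)).toNat - part x.2 else 0 := by
    rintro ⟨t, i⟩ hx
    have h := hne t i hx
    dsimp only
    rw [key t i h, if_pos ⟨i.2, by omega⟩]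
  refine finsum_mem_eq_of_bijOn (fun x : ℕ × Fin n => ((x.2 : ℕ), (x.2 : ℕ) + m + (x.1 + d) - n))
    ⟨?_, ?_, ?_⟩ hval
  · intro x hx
    rw [Function.mem_support, ← hval x hx]
    exact hx
  · rintro ⟨t, i⟩ hx ⟨t', i'⟩ hx' h
    have h1 := hne t i hx
    have h2 := hne t' i' hx'
    simp only [Prod.mk.injEq] at h
    obtain rfl : i = i' := Fin.ext h.1
    simp only [Prod.mk.injEq, and_true]
    omega
  · rintro ⟨i, j⟩ hq
    rw [Function.mem_support] at hq
    by_cases h : i < n ∧ i + m + d ≤ j + n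
    · rw [if_pos h] at hq
      have hj : i + m + (j + n - m - i - d + d) - n = j := by omega
      refine ⟨(j + n - m - i - d, ⟨i, h.1⟩), ?_, Prod.ext rfl hj⟩
      rw [Function.mem_support, key _ _ (by dsimp only; omega)]
      dsimp only
      rw [hj]
      exact hq
    · exact absurd (if_neg h) hq

theorem finsum_prod_excess {n : ℕ} {b N : Fin n → ℕ} {c : ℕ → Fin n → ℕ∞} (h : IsPath b N c)
    (d : ℕ) : ∑ᶠ x : ℕ × Fin n, ((c (x.1 + d) x.2).toNat - N x.2)
      = ∑ᶠ t, excess N (c (t + d)) := by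
  obtain ⟨T, hT⟩ := h.exists_forall_eq
  rw [finsum_curry]
  · exact finsum_congr fun t => finsum_eq_sum_of_fintype _
  · refine ((Set.finite_Iio T).prod Set.finite_univ).subset ?_
    rintro ⟨t, i⟩ hx
    refine ⟨?_, Set.mem_univ _⟩
    by_contra ht
    apply hx
    have := hT (t + d) (by simp only [Set.mem_Iio] at ht; omega) i
    simp [this]

/-- If the lower box lies in the right half, the inequality is interlacing of `p`; otherwise,
outside the pit, both boxes lie in the closed left half and it is monotonicity of `p'` in time.
Transposition yields the row inequalities. -/
theorem succ_le_of_halves {b N : Fin n → ℕ} {b' N' : Fin m → ℕ} {p : ℕ → Fin n → ℕ∞}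
    {p' : ℕ → Fin m → ℕ∞} (hp : IsPath b N p) (hp' : IsPath b' N' p')
    (hR : ∀ i j (hi : i < n), i + m ≤ j + n →
      a i j + ((n - 1 - i : ℕ) : ℕ∞) = p (j + n - m - i) ⟨i, hi⟩)
    (hL : ∀ i j (hj : j < m), j + n ≤ i + m →
      a i j + ((m - 1 - j : ℕ) : ℕ∞) = p' (i + m - n - j) ⟨j, hj⟩)
    (h0 : ∀ i j, n ≤ i → m ≤ j → a i j = 0) (i j : ℕ) : a (i + 1) j ≤ a i j := by
  by_cases hpit : n ≤ i + 1 ∧ m ≤ j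
  · rw [h0 _ _ hpit.1 hpit.2]; exact zero_le
  · by_cases hr : i + 1 + m ≤ j + n
    · have h1 := hR (i + 1) j (by omega) hr
      have h2 := hR i j (by omega) (by omega)
      have h3 := hp.interlace (j + n - m - (i + 1)) ⟨i, by omega⟩ ⟨i + 1, by omega⟩ rfl
      rw [show j + n - m - (i + 1) + 1 = j + n - m - i by omega, ← h1, ← h2,
        show n - 1 - i = n - 1 - (i + 1) + 1 by omega, Nat.cast_add, ← add_assoc] at h3
      exact (ENat.add_le_add_iff_right (by simp)).1 ((ENat.add_le_add_iff_right (by simp)).1 h3)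
    · have h1 := hL (i + 1) j (by omega) (by omega)
      have h2 := hL i j (by omega) (by omega)
      have h3 := hp'.anti (i + m - n - j) ⟨j, by omega⟩
      rw [show i + m - n - j + 1 = i + 1 + m - n - j by omega, ← h1, ← h2] at h3
      exact (ENat.add_le_add_iff_right (by simp)).1 h3

theorem tendsto_of_half {b : Fin n → ℕ} {p : ℕ → Fin n → ℕ∞}
    (hp : IsPath b (shiftedPart n part) p)
    (hR : ∀ i j (hi : i < n), i + m ≤ j + n →
      a i j + ((n - 1 - i : ℕ) : ℕ∞) = p (j + n - m - i) ⟨i, hi⟩)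
    (h0 : ∀ i j, n ≤ i → m ≤ j → a i j = 0) (hpart : ∀ i, n ≤ i → part i = 0) (i : ℕ) :
    Tendsto (fun j => a i j) atTop (𝓝 (part i : ℕ∞)) := by
  rw [ENat.nhds_natCast, tendsto_pure]
  by_cases hi : i < n
  · obtain ⟨T, hT⟩ := eventually_atTop.1 (hp.eventually_eq ⟨i, hi⟩)
    filter_upwards [eventually_ge_atTop (T + m + i)] with j hj
    have h1 := hR i j hi (by omega)
    rw [hT _ (by omega), shiftedPart, Nat.cast_add] at h1
    exact ENat.add_left_injective_of_ne_top (by simp) h1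
  · filter_upwards [eventually_ge_atTop m] with j hj
    rw [h0 i j (by omega) hj, hpart i (by omega)]
    rfl

end Halves

/-! ### Plane partitions as pairs of paths agreeing on the diagonal. -/

section Bijection

variable {n m : ℕ} {mu nu lam : YoungDiagram}

theorem PlanePartition.ext_entry {a a' : PlanePartition n m mu nu lam}
    (h : ∀ i j, a.entry i j = a'.entry i j) : a = a' := by
  cases a
  cases a'
  congr 1
  funext i j
  exact h i j

theorem PlanePartition.entry_eq_top_iff_rowLen (a : PlanePartition n m mu nu lam) (i j : ℕ) :
    a.entry i j = ⊤ ↔ j < lam.rowLen i :=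
  (a.eq_top_iff i j).trans YoungDiagram.mem_iff_lt_rowLen

theorem PlanePartition.entry_eq_top_iff_colLen (a : PlanePartition n m mu nu lam) (i j : ℕ) :
    a.entry i j = ⊤ ↔ i < lam.colLen j :=
  (a.eq_top_iff i j).trans YoungDiagram.mem_iff_lt_colLen

theorem PlanePartition.entry_eq_zero (a : PlanePartition n m mu nu lam) {i j : ℕ} (hi : n ≤ i)
    (hj : m ≤ j) : a.entry i j = 0 := by
  have hc : Antitone fun i => a.entry i j := antitone_nat_of_succ_le fun i => a.col_le i j
  have hr : Antitone fun j => a.entry n j := antitone_nat_of_succ_le fun j => a.row_le n j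
  exact le_antisymm (((hc hi).trans (hr hj)).trans a.pit.le) zero_le

theorem PlanePartition.le_entry_row (a : PlanePartition n m mu nu lam) (i j : ℕ) :
    (nu.rowLen i : ℕ∞) ≤ a.entry i j :=
  (antitone_nat_of_succ_le fun j => a.row_le i j).le_of_tendsto (a.tendsto_row i) j

theorem PlanePartition.le_entry_col (a : PlanePartition n m mu nu lam) (i j : ℕ) :
    (mu.rowLen j : ℕ∞) ≤ a.entry i j :=
  (antitone_nat_of_succ_le fun i => a.col_le i j).le_of_tendsto (a.tendsto_col j) i

/-- The paths of the upper right half of a plane partition. -/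
abbrev RightPath (n m : ℕ) (nu lam : YoungDiagram) :=
  Path (birth n m lam.rowLen) (shiftedPart n nu.rowLen)

/-- The paths of the lower left half of a plane partition. -/
abbrev LeftPath (n m : ℕ) (mu lam : YoungDiagram) :=
  Path (birth m n lam.colLen) (shiftedPart m mu.rowLen)

/-- The two halves of a plane partition agree on the common diagonal. -/
def Agree (X : Fin n → ℕ∞) (X' : Fin m → ℕ∞) : Prop :=
  ∀ (i : Fin n) (j : Fin m), (i : ℕ) + m = j + n → X i = X' j

/-- The upper right half of a plane partition. -/
def PlanePartition.right (a : PlanePartition n m mu nu lam) : RightPath n m nu lam :=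
  ⟨halfPath n m a.entry, isPath_halfPath a.col_le a.row_le a.entry_eq_top_iff_rowLen
    a.tendsto_row⟩

/-- The lower left half of a plane partition. -/
def PlanePartition.left (a : PlanePartition n m mu nu lam) : LeftPath n m mu lam :=
  ⟨halfPath m n fun j i => a.entry i j, isPath_halfPath (fun j i => a.row_le i j)
    (fun j i => a.col_le i j) (fun j i => a.entry_eq_top_iff_colLen i j) a.tendsto_col⟩

theorem PlanePartition.agree (a : PlanePartition n m mu nu lam) :
    Agree (a.right.1 0) (a.left.1 0) := fun i j hij => by
  have h1 : a.right.1 0 i = a.entry i j + ((n - 1 - i : ℕ) : ℕ∞) := by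
    change halfPath n m a.entry 0 i = _
    rw [halfPath, if_neg (by omega), show (i : ℕ) + m + 0 - n = j by omega]
  have h2 : a.left.1 0 j = a.entry i j + ((m - 1 - j : ℕ) : ℕ∞) := by
    change halfPath m n (fun j i => a.entry i j) 0 j = _
    rw [halfPath, if_neg (by omega), show (j : ℕ) + n + 0 - m = i by omega]
  rw [h1, h2, show n - 1 - (i : ℕ) = m - 1 - j by omega]

/-- The entries of the plane partition with the given halves. -/
def glue (p : ℕ → Fin n → ℕ∞) (p' : ℕ → Fin m → ℕ∞) (i j : ℕ) : ℕ∞ :=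
  if h : i < n ∧ i + m ≤ j + n then p (j + n - m - i) ⟨i, h.1⟩ - ((n - 1 - i : ℕ) : ℕ∞)
  else if h' : j < m then p' (i + m - n - j) ⟨j, h'⟩ - ((m - 1 - j : ℕ) : ℕ∞)
  else 0

theorem glue_right (p : RightPath n m nu lam) (p' : LeftPath n m mu lam) (i j : ℕ) (hi : i < n)
    (h : i + m ≤ j + n) :
    glue p.1 p'.1 i j + ((n - 1 - i : ℕ) : ℕ∞) = p.1 (j + n - m - i) ⟨i, hi⟩ := by
  rw [glue, dif_pos ⟨hi, h⟩]
  -- The subtraction in `glue` is exact: positions never drop below `N_i ≥ n - 1 - i`.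
  refine tsub_add_cancel_of_le (le_trans ?_ (p.2.le _ _))
  rw [shiftedPart, Nat.cast_add]
  exact le_add_self

theorem glue_left {p : RightPath n m nu lam} {p' : LeftPath n m mu lam}
    (hagree : Agree (p.1 0) (p'.1 0)) (i j : ℕ) (hj : j < m) (h : j + n ≤ i + m) :
    glue p.1 p'.1 i j + ((m - 1 - j : ℕ) : ℕ∞) = p'.1 (i + m - n - j) ⟨j, hj⟩ := by
  -- On the common diagonal `glue` reads the right half, and agreement transfers the value to the
  -- left one.
  by_cases hij : i < n ∧ i + m ≤ j + n
  · have h1 := glue_right p p' i j hij.1 hij.2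
    rw [show n - 1 - i = m - 1 - j by omega, show j + n - m - i = 0 by omega] at h1
    rw [h1, show i + m - n - j = 0 by omega]
    exact hagree _ _ (by dsimp only; omega)
  · rw [glue, dif_neg hij, dif_pos hj]
    refine tsub_add_cancel_of_le (le_trans ?_ (p'.2.le _ _))
    rw [shiftedPart, Nat.cast_add]
    exact le_add_self

theorem glue_pit (p : ℕ → Fin n → ℕ∞) (p' : ℕ → Fin m → ℕ∞) (i j : ℕ) (hi : n ≤ i) (hj : m ≤ j) :
    glue p p' i j = 0 := by
  rw [glue, dif_neg (by omega), dif_neg (by omega)]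

theorem rowLen_eq_zero {nu : YoungDiagram} (hnu : nu.colLen 0 ≤ n) (i : ℕ) (hi : n ≤ i) :
    nu.rowLen i = 0 := by
  by_contra h
  have h1 : (i, 0) ∈ nu := YoungDiagram.mem_iff_lt_rowLen.2 (Nat.pos_of_ne_zero h)
  have := YoungDiagram.mem_iff_lt_colLen.1 h1
  omega

theorem notMem_of_le (hlam : lam.rowLen n < m + 1) {i j : ℕ} (hi : n ≤ i) (hj : m ≤ j) :
    (i, j) ∉ lam := fun h => by
  have h1 : (n, m) ∈ lam := lam.up_left_mem hi hj h
  have := YoungDiagram.mem_iff_lt_rowLen.1 h1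
  omega

theorem glue_eq_top_iff (hlam : lam.rowLen n < m + 1) {p : RightPath n m nu lam}
    {p' : LeftPath n m mu lam} (hagree : Agree (p.1 0) (p'.1 0)) (i j : ℕ) :
    glue p.1 p'.1 i j = ⊤ ↔ (i, j) ∈ lam := by
  have hadd : ∀ (x : ℕ∞) (k : ℕ), x = ⊤ ↔ x + k = ⊤ := fun x k => by
    rw [ENat.add_eq_top]; simp
  by_cases hpit : n ≤ i ∧ m ≤ j
  · rw [glue_pit _ _ _ _ hpit.1 hpit.2]
    simp [notMem_of_le hlam hpit.1 hpit.2]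
  · by_cases hr : i + m ≤ j + n
    · rw [hadd _ (n - 1 - i), glue_right p p' i j (by omega) hr, p.2.top_iff,
        YoungDiagram.mem_iff_lt_rowLen, birth]
      dsimp only
      omega
    · rw [hadd _ (m - 1 - j), glue_left hagree i j (by omega) (by omega), p'.2.top_iff,
        YoungDiagram.mem_iff_lt_colLen, birth]
      dsimp only
      omega

/-- A plane partition is the same as a pair of paths that agree on the common diagonal. -/
def halvesEquiv (hnu : nu.colLen 0 ≤ n) (hmu : mu.colLen 0 ≤ m) (hlam : lam.rowLen n < m + 1) :
    PlanePartition n m mu nu lam ≃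
      {p : RightPath n m nu lam × LeftPath n m mu lam // Agree (p.1.1 0) (p.2.1 0)} where
  toFun a := ⟨(a.right, a.left), a.agree⟩
  invFun p :=
    { entry := glue p.1.1.1 p.1.2.1
      col_le := succ_le_of_halves p.1.1.2 p.1.2.2 (glue_right p.1.1 p.1.2) (glue_left p.2)
        (glue_pit _ _)
      row_le := fun i j => succ_le_of_halves (a := fun j i => glue p.1.1.1 p.1.2.1 i j)
        p.1.2.2 p.1.1.2 (fun j i hj h => glue_left p.2 i j hj h)
        (fun j i hi h => glue_right p.1.1 p.1.2 i j hi h)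
        (fun j i hj hi => glue_pit _ _ i j hi hj) j i
      pit := glue_pit _ _ _ _ le_rfl le_rfl
      tendsto_row := tendsto_of_half p.1.1.2 (glue_right p.1.1 p.1.2) (glue_pit _ _)
        (rowLen_eq_zero hnu)
      tendsto_col := fun j => tendsto_of_half (a := fun j i => glue p.1.1.1 p.1.2.1 i j) p.1.2.2
        (fun j i hj h => glue_left p.2 i j hj h) (fun j i hj hi => glue_pit _ _ i j hi hj)
        (rowLen_eq_zero hmu) j
      eq_top_iff := glue_eq_top_iff hlam p.2 }
  left_inv a := by
    refine PlanePartition.ext_entry fun i j => ?_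
    change glue a.right.1 a.left.1 i j = a.entry i j
    by_cases hpit : n ≤ i ∧ m ≤ j
    · rw [glue_pit _ _ _ _ hpit.1 hpit.2, a.entry_eq_zero hpit.1 hpit.2]
    · by_cases hr : i + m ≤ j + n
      · have h := glue_right a.right a.left i j (by omega) hr
        refine ENat.add_left_injective_of_ne_top (by simp) (h.trans ?_)
        change halfPath n m a.entry _ _ = _
        rw [halfPath, if_neg (by dsimp only; omega)]
        dsimp only
        rw [show i + m + (j + n - m - i) - n = j by omega]
      · have h := glue_left a.agree i j (by omega) (by omega)
        refine ENat.add_left_injective_of_ne_top (by simp) (h.trans ?_)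
        change halfPath m n (fun j i => a.entry i j) _ _ = _
        rw [halfPath, if_neg (by dsimp only; omega)]
        dsimp only
        rw [show j + n + (i + m - n - j) - m = i by omega]
  right_inv p := by
    refine Subtype.ext (Prod.ext (Subtype.ext (funext fun t => funext fun i => ?_))
      (Subtype.ext (funext fun t => funext fun j => ?_)))
    · change halfPath n m (glue p.1.1.1 p.1.2.1) t i = p.1.1.1 t i
      rw [halfPath]
      split_ifs with h
      · refine ((p.1.1.2.top_iff t i).2 ?_).symm
        rw [birth]
        omega
      · rw [glue_right p.1.1 p.1.2 _ _ i.2 (by omega)]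
        rw [show (i : ℕ) + m + t - n + n - m - i = t by omega]
    · change halfPath m n (fun j i => glue p.1.1.1 p.1.2.1 i j) t j = p.1.2.1 t j
      rw [halfPath]
      split_ifs with h
      · refine ((p.1.2.2.top_iff t j).2 ?_).symm
        rw [birth]
        omega
      · rw [glue_left p.2 _ _ j.2 (by omega)]
        rw [show (j : ℕ) + n + t - m + m - n - j = t by omega]

/-- Entries dominate their limits, so the truncated differences are exact. Boxes of `λ` give zero
because `toNat ⊤ = 0`, and boxes beyond the pit because the entry is zero. -/
theorem PlanePartition.boxWeight_eq (a : PlanePartition n m mu nu lam) (q : ℕ × ℕ) :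
    a.boxWeight q = (((if q.1 < n ∧ q.1 + m + 0 ≤ q.2 + n then
        (a.entry q.1 q.2).toNat - nu.rowLen q.1 else 0)
      + (if q.2 < m ∧ q.2 + n + 1 ≤ q.1 + m then
        (a.entry q.1 q.2).toNat - mu.rowLen q.2 else 0) : ℕ) : ℤ) := by
  obtain ⟨i, j⟩ := q
  unfold boxWeight
  by_cases hl : (i, j) ∈ lam
  · have := (a.eq_top_iff i j).2 hl
    simp [hl, this]
  · have hne : a.entry i j ≠ ⊤ := fun h => hl ((a.eq_top_iff i j).1 h)
    have h1 := a.le_entry_row i j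
    have h2 := a.le_entry_col i j
    have h0 := fun hi hj => a.entry_eq_zero (i := i) (j := j) hi hj
    rw [if_neg hl]
    dsimp only
    lift a.entry i j to ℕ using hne with x
    rw [ENat.toNat_natCast]
    replace h1 : nu.rowLen i ≤ x := by exact_mod_cast h1
    replace h2 : mu.rowLen j ≤ x := by exact_mod_cast h2
    replace h0 : n ≤ i → m ≤ j → x = 0 := fun hi hj => by exact_mod_cast h0 hi hj
    by_cases hpit : n ≤ i ∧ m ≤ j
    · have := h0 hpit.1 hpit.2
      split_ifs <;> omega
    · split_ifs <;> omega

/-- The diagonal is charged to the right half only, with limits `ν`, as in the grading. -/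
theorem PlanePartition.weight_eq (a : PlanePartition n m mu nu lam) :
    a.weight = ((excess (shiftedPart n nu.rowLen) (a.right.1 0)
      + pathWeight (shiftedPart n nu.rowLen) a.right.1
      + pathWeight (shiftedPart m mu.rowLen) a.left.1 : ℕ) : ℤ) := by
  have hfin := a.finite_support_boxWeight
  have hsupp : ∀ f g : ℕ × ℕ → ℕ, (∀ q, a.boxWeight q = ((f q + g q : ℕ) : ℤ)) →
      f.support.Finite ∧ g.support.Finite := fun f g h => by
    constructor <;>
    · refine hfin.subset fun q hq => ?_
      rw [Function.mem_support] at hq ⊢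
      rw [h q]
      omega
  have h1 := hsupp _ _ a.boxWeight_eq
  have h2 : ∀ f : ℕ × ℕ → ℕ, f.support.Finite →
      ∑ᶠ q, ((f q : ℕ) : ℤ) = ((∑ᶠ q, f q : ℕ) : ℤ) := fun f hf =>
    ((Nat.castAddMonoidHom ℤ).map_finsum hf).symm
  rw [weight, finsum_congr a.boxWeight_eq, h2 _ ((h1.1.union h1.2).subset
    (Function.support_add _ _)), finsum_add_distrib h1.1 h1.2,
    finsum_halfPath n m a.entry nu.rowLen 0,
    ← finsum_comp_equiv (Equiv.prodComm ℕ ℕ)]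
  have h3 := finsum_halfPath m n (fun j i => a.entry i j) mu.rowLen 1
  rw [← finsum_excess_eq_add a.right.2]
  congr 2
  · exact finsum_prod_excess a.right.2 0
  · exact h3.trans (finsum_prod_excess a.left.2 1)

end Bijection

end PitPartition

namespace PitPartition

/-! ### Bordered determinants and Cauchy-Binet. -/

section Bordered

variable {n m r : ℕ}

/-- The square matrix with the `r` rows `top` followed by the `n - r` rows `bot`. -/
def bordered (top : Fin r → Fin n → LaurentSeries ℚ)
    (bot : Fin (n - r) → Fin n → LaurentSeries ℚ) : Matrix (Fin n) (Fin n) (LaurentSeries ℚ) :=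
  Matrix.of fun i l => if h : (i : ℕ) < r then top ⟨i, h⟩ l else bot ⟨i - r, by omega⟩ l

theorem bordered_castLE (hr : r ≤ n) (top : Fin r → Fin n → LaurentSeries ℚ)
    (bot : Fin (n - r) → Fin n → LaurentSeries ℚ) (k : Fin r) :
    bordered top bot (k.castLE hr) = top k := by
  funext l
  simp [bordered]

theorem bordered_add (top : Fin r → Fin n → LaurentSeries ℚ)
    (bot : Fin (n - r) → Fin n → LaurentSeries ℚ) (k : Fin (n - r)) :
    bordered top bot ⟨r + k, Nat.add_lt_of_lt_sub' k.isLt⟩ = bot k := by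
  funext l
  simp [bordered]

theorem prod_univ_split {M : Type*} [CommMonoid M] (hr : r ≤ n) (f : Fin n → M) :
    ∏ i, f i = (∏ k : Fin r, f (k.castLE hr))
      * ∏ k : Fin (n - r), f ⟨r + k, Nat.add_lt_of_lt_sub' k.isLt⟩ := by
  obtain ⟨d, rfl⟩ := Nat.exists_eq_add_of_le hr
  rw [Fin.prod_univ_add]
  congr 1
  exact Fintype.prod_equiv (finCongr (by omega)) _ _ fun k => rfl

theorem det_bordered (hr : r ≤ n) (top : Fin r → Fin n → LaurentSeries ℚ)
    (bot : Fin (n - r) → Fin n → LaurentSeries ℚ) :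
    (bordered top bot).det = ∑ σ : Equiv.Perm (Fin n), ((Equiv.Perm.sign σ : ℤ) : LaurentSeries ℚ)
      * ((∏ k : Fin r, top k (σ (k.castLE hr)))
        * ∏ k : Fin (n - r), bot k (σ ⟨r + k, Nat.add_lt_of_lt_sub' k.isLt⟩)) := by
  rw [det_eq_sum_sign]
  refine Finset.sum_congr rfl fun σ _ => ?_
  rw [prod_univ_split hr]
  simp only [bordered_castLE, bordered_add]

theorem det_bordered_comp_perm (hr : r ≤ n) (top : Fin r → Fin n → LaurentSeries ℚ)
    (bot : Fin (n - r) → Fin n → LaurentSeries ℚ) (ρ : Equiv.Perm (Fin r)) :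
    (bordered (top ∘ ρ) bot).det
      = ((Equiv.Perm.sign ρ : ℤ) : LaurentSeries ℚ) * (bordered top bot).det := by
  rw [← Equiv.Perm.viaFintypeEmbedding_sign ρ (Fin.castLEEmb hr), ← Matrix.det_permute]
  congr 1
  ext1 i l
  by_cases h : (i : ℕ) < r
  · obtain ⟨k, rfl⟩ : ∃ k : Fin r, i = Fin.castLEEmb hr k := ⟨⟨i, h⟩, rfl⟩
    rw [Matrix.submatrix_apply, Equiv.Perm.viaFintypeEmbedding_apply_image]
    exact (congrFun (bordered_castLE hr _ _ _) l).trans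
      (congrFun (bordered_castLE hr top bot _) l).symm
  · rw [Matrix.submatrix_apply, Equiv.Perm.viaFintypeEmbedding_apply_notMem_range]
    · simp [bordered, h]
    · rintro ⟨k, rfl⟩
      exact h k.2

theorem det_bordered_eq_zero_of_not_injective (hr : r ≤ n) {f : ℕ → Fin n → LaurentSeries ℚ}
    (bot : Fin (n - r) → Fin n → LaurentSeries ℚ) {x : Fin r → ℕ} (hx : ¬ Function.Injective x) :
    (bordered (fun k => f (x k)) bot).det = 0 := by
  simp only [Function.Injective, not_forall] at hx
  obtain ⟨k, k', h, hne⟩ := hx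
  refine Matrix.det_zero_of_row_eq (i := k.castLE hr) (j := k'.castLE hr)
    (fun h' => hne (Fin.castLE_injective hr h')) ?_
  rw [bordered_castLE, bordered_castLE, h]

theorem det_bordered_eq_zero_of_eq (hr : r ≤ n) {top : Fin r → Fin n → LaurentSeries ℚ}
    {bot : Fin (n - r) → Fin n → LaurentSeries ℚ} {k : Fin r} {j : Fin (n - r)}
    (h : top k = bot j) : (bordered top bot).det = 0 := by
  refine Matrix.det_zero_of_row_eq (i := k.castLE hr)
    (j := ⟨r + j, Nat.add_lt_of_lt_sub' j.isLt⟩) (fun h' => ?_) ?_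
  · have := congrArg Fin.val h'
    have hk := k.2
    simp only [Fin.val_castLE] at this
    omega
  · rw [bordered_castLE, bordered_add, h]

theorem finRotate_pow_val (r : ℕ) (i : Fin n) :
    (((finRotate n ^ r) i : Fin n) : ℕ) = (i + r) % n := by
  cases n with
  | zero => exact i.elim0
  | succ n =>
    induction r with
    | zero => simp [Nat.mod_eq_of_lt i.2]
    | succ r ih =>
      rw [pow_succ', Equiv.Perm.mul_apply, finRotate_apply, Fin.val_add, ih, Fin.val_one',
        ← Nat.add_mod, add_assoc]

/-- Moving the last `r` rows of a matrix to the front. -/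
theorem det_rotate (hr : r ≤ n) (top : Fin r → Fin n → LaurentSeries ℚ)
    (bot : Fin (n - r) → Fin n → LaurentSeries ℚ) :
    (Matrix.of fun i l : Fin n => if h : n - r ≤ (i : ℕ) then
      top ⟨i - (n - r), by omega⟩ l else bot ⟨i, by omega⟩ l).det
      = (-1) ^ (r * (n - 1)) * (bordered top bot).det := by
  -- Moving one row from the end to the front is an `n`-cycle, of sign `(-1)^(n-1)`; this is done
  -- `r` times.
  have hsign : ((Equiv.Perm.sign (finRotate n ^ r) : ℤ) : LaurentSeries ℚ)
      = (-1) ^ (r * (n - 1)) := by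
    rw [map_pow, sign_finRotate, ← pow_mul, mul_comm]
    push_cast
    rfl
  rw [← hsign, ← Matrix.det_permute]
  congr 1
  ext1 i l
  have hi := i.2
  rw [Matrix.submatrix_apply, Matrix.of_apply, bordered, Matrix.of_apply]
  by_cases h : n - r ≤ (i : ℕ)
  · have h1 : (((finRotate n ^ r) i : Fin n) : ℕ) = i - (n - r) := by
      rw [finRotate_pow_val, show (i : ℕ) + r = i - (n - r) + n by omega, Nat.add_mod_right,
        Nat.mod_eq_of_lt (by omega)]
    rw [dif_pos h, dif_pos (by omega)]
    congr 2
    exact h1.symm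
  · have h1 : (((finRotate n ^ r) i : Fin n) : ℕ) = i + r := by
      rw [finRotate_pow_val, Nat.mod_eq_of_lt (by omega)]
    rw [dif_neg h, dif_neg (by omega)]
    congr 2
    omega

/-- The double alternating sum that arises from summing a product of two bordered determinants. -/
noncomputable def borderedPairing (hn : r ≤ n) (hm : r ≤ m)
    (bot : Fin (n - r) → Fin n → LaurentSeries ℚ)
    (bot' : Fin (m - r) → Fin m → LaurentSeries ℚ) (H : Fin n → Fin m → LaurentSeries ℚ) :
    LaurentSeries ℚ :=
  ∑ σ : Equiv.Perm (Fin n), ∑ τ : Equiv.Perm (Fin m),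
    ((Equiv.Perm.sign σ : ℤ) : LaurentSeries ℚ) * ((Equiv.Perm.sign τ : ℤ) : LaurentSeries ℚ)
      * (∏ k : Fin (n - r), bot k (σ ⟨r + k, Nat.add_lt_of_lt_sub' k.isLt⟩))
      * (∏ k : Fin (m - r), bot' k (τ ⟨r + k, Nat.add_lt_of_lt_sub' k.isLt⟩))
      * ∏ k : Fin r, H (σ (k.castLE hn)) (τ (k.castLE hm))

theorem borderedPairing_mul (hn : r ≤ n) (hm : r ≤ m)
    (bot : Fin (n - r) → Fin n → LaurentSeries ℚ)
    (bot' : Fin (m - r) → Fin m → LaurentSeries ℚ) (H : Fin n → Fin m → LaurentSeries ℚ)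
    (c : LaurentSeries ℚ) : borderedPairing hn hm bot bot' (fun l l' => H l l' * c)
      = borderedPairing hn hm bot bot' H * c ^ r := by
  simp only [borderedPairing, Finset.sum_mul]
  refine Finset.sum_congr rfl fun σ _ => Finset.sum_congr rfl fun τ _ => ?_
  rw [Finset.prod_mul_distrib, Finset.prod_const, Finset.card_univ, Fintype.card_fin]
  ring

theorem det_bordered_mul_det_bordered (hn : r ≤ n) (hm : r ≤ m)
    (f : ℕ → Fin n → LaurentSeries ℚ) (g : ℕ → Fin m → LaurentSeries ℚ)
    (bot : Fin (n - r) → Fin n → LaurentSeries ℚ)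
    (bot' : Fin (m - r) → Fin m → LaurentSeries ℚ) (x : Fin r → ℕ) :
    (bordered (fun k => f (x k)) bot).det * (bordered (fun k => g (x k)) bot').det
      = ∑ σ : Equiv.Perm (Fin n), ∑ τ : Equiv.Perm (Fin m),
        ((Equiv.Perm.sign σ : ℤ) : LaurentSeries ℚ) * ((Equiv.Perm.sign τ : ℤ) : LaurentSeries ℚ)
        * (∏ k : Fin (n - r), bot k (σ ⟨r + k, Nat.add_lt_of_lt_sub' k.isLt⟩))
        * (∏ k : Fin (m - r), bot' k (τ ⟨r + k, Nat.add_lt_of_lt_sub' k.isLt⟩))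
        * ∏ k : Fin r, f (x k) (σ (k.castLE hn)) * g (x k) (τ (k.castLE hm)) := by
  rw [det_bordered hn, det_bordered hm, Finset.sum_mul_sum]
  refine Finset.sum_congr rfl fun σ _ => Finset.sum_congr rfl fun τ _ => ?_
  rw [Finset.prod_mul_distrib]
  ring

/-- A Cauchy-Binet identity for bordered determinants. -/
theorem hasSum_det_bordered_mul (hn : r ≤ n) (hm : r ≤ m)
    {f : ℕ → Fin n → LaurentSeries ℚ} {g : ℕ → Fin m → LaurentSeries ℚ}
    {H : Fin n → Fin m → LaurentSeries ℚ}
    (hH : ∀ l l', HasSum (fun x => f x l * g x l') (H l l'))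
    (bot : Fin (n - r) → Fin n → LaurentSeries ℚ)
    (bot' : Fin (m - r) → Fin m → LaurentSeries ℚ) :
    HasSum (fun x : {x : Fin r → ℕ // StrictAnti x} =>
        (bordered (fun k => f (x.1 k)) bot).det * (bordered (fun k => g (x.1 k)) bot').det)
      ((r.factorial : LaurentSeries ℚ)⁻¹ * borderedPairing hn hm bot bot' H) := by
  refine hasSum_strictAnti (T := fun x => (bordered (fun k => f (x k)) bot).det
    * (bordered (fun k => g (x k)) bot').det) ?_ ?_ ?_
  -- Permuting `x` multiplies both determinants by the same sign, so the product is symmetric.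
  · intro x ρ
    have h1 := det_bordered_comp_perm hn (fun k => f (x k)) bot ρ
    have h2 := det_bordered_comp_perm hm (fun k => g (x k)) bot' ρ
    have h3 : ((Equiv.Perm.sign ρ : ℤ) : LaurentSeries ℚ) * ((Equiv.Perm.sign ρ : ℤ) :
        LaurentSeries ℚ) = 1 := by
      rcases Int.units_eq_one_or (Equiv.Perm.sign ρ) with h | h <;> simp [h]
    change (bordered ((fun k => f (x k)) ∘ ρ) bot).det * (bordered ((fun k => g (x k)) ∘ ρ) bot').det
      = _
    rw [h1, h2, mul_mul_mul_comm, h3, one_mul]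
  · intro x hx
    rw [det_bordered_eq_zero_of_not_injective hn bot hx, zero_mul]
  · simp only [det_bordered_mul_det_bordered hn hm f g]
    exact hasSum_sum fun σ _ => hasSum_sum fun τ _ => (hasSum_pi_prod fun k => hH _ _).mul_left _

end Bordered

end PitPartition

namespace PitPartition

/-! ### The number `r` counts the finite entries on the diagonal. -/

section Diagonal

variable {n m : ℕ} {mu nu lam : YoungDiagram}

theorem atypCond_atyp (n m : ℕ) (lam : YoungDiagram) : atyp n m lam = n ∨
    (atyp n m lam < n ∧ (m : ℤ) - atyp n m lam ≤ lam.rowLen (n - atyp n m lam - 1)) :=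
  Nat.find_spec (exists_atypCond n m lam)

/-- The defining condition of `r` at `t = n - 1 - i` says that particle `i` starts at infinity. It
fails for `t < r` by minimality, and it holds for the earlier rows because `λ` is decreasing. -/
theorem birth_rowLen_eq_zero_iff (n m : ℕ) (lam : YoungDiagram) (i : Fin n) :
    birth n m lam.rowLen i = 0 ↔ n - atyp n m lam ≤ i := by
  have hi := i.2
  unfold birth
  constructor
  · intro h
    by_contra hlt
    rcases atypCond_atyp n m lam with h1 | h1
    · omega
    · have h2 := lam.rowLen_anti (i : ℕ) (n - atyp n m lam - 1) (by omega)
      omega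
  · intro h
    have h1 : ¬ AtypCond n m lam (n - 1 - i) := Nat.find_min (exists_atypCond n m lam)
      (show n - 1 - (i : ℕ) < atyp n m lam by omega)
    unfold AtypCond at h1
    rw [show n - (n - 1 - (i : ℕ)) - 1 = i by omega] at h1
    omega

theorem birth_colLen_eq_zero_iff (n m : ℕ) (lam : YoungDiagram) (j : Fin m) :
    birth m n lam.colLen j = 0 ↔ m - atyp n m lam ≤ j := by
  have hj := j.2
  have hr := atyp_le_left n m lam
  have hr' := atyp_le_right n m lam
  unfold birth
  constructor
  · intro h
    by_contra hlt
    rcases atypCond_atyp n m lam with h1 | h1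
    · omega
    · have h2 : (n - atyp n m lam - 1, (j : ℕ)) ∈ lam :=
        YoungDiagram.mem_iff_lt_rowLen.2 (by omega)
      have h3 := YoungDiagram.mem_iff_lt_colLen.1 h2
      omega
  · intro h
    -- The row `n - 1 - (m - 1 - j)` is where column `j` meets the common diagonal, so the row
    -- version applies.
    have h1 := (birth_rowLen_eq_zero_iff n m lam ⟨n - 1 - (m - 1 - j), by omega⟩).2
      (by dsimp only; omega)
    unfold birth at h1
    dsimp only at h1
    by_contra h2
    have h3 : (n - 1 - (m - 1 - j), (j : ℕ)) ∈ lam :=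
      YoungDiagram.mem_iff_lt_colLen.2 (by omega)
    have h4 := YoungDiagram.mem_iff_lt_rowLen.1 h3
    omega

theorem birth_lt_birth {len : ℕ → ℕ} (h : Antitone len) (i j : Fin n) (hij : (j : ℕ) = i + 1)
    (hj : 0 < birth n m len j) : birth n m len j < birth n m len i := by
  have := h (show (i : ℕ) ≤ j by omega)
  unfold birth at *
  omega

theorem shiftedPart_strictAnti {part : ℕ → ℕ} (h : Antitone part) :
    StrictAnti (shiftedPart n part) := fun i j hij => by
  have hij' : (i : ℕ) < j := hij
  have := h hij'.le
  have := j.2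
  unfold shiftedPart
  omega

theorem rowLen_antitone (lam : YoungDiagram) : Antitone lam.rowLen := fun _ _ h =>
  lam.rowLen_anti _ _ h

theorem colLen_antitone (lam : YoungDiagram) : Antitone lam.colLen := fun _ _ h =>
  lam.colLen_anti _ _ h

end Diagonal

/-! ### States on the common diagonal. -/

section Start

variable {n m r : ℕ}

/-- The state in which the first `n - r` particles are at infinity and the last `r` particles are
at the points `x`. -/
def fillTop (n : ℕ) (x : Fin r → ℕ) (i : Fin n) : ℕ∞ :=
  if h : n - r ≤ (i : ℕ) then (x ⟨i - (n - r), by omega⟩ : ℕ∞) else ⊤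

theorem fillTop_apply (hr : r ≤ n) (x : Fin r → ℕ) (k : Fin r) :
    fillTop n x ⟨n - r + k, by omega⟩ = x k := by
  rw [fillTop, dif_pos (by dsimp only; omega)]
  congr 2
  exact Fin.ext (by dsimp only; omega)

theorem fillTop_injective (hr : r ≤ n) : Function.Injective (fillTop (r := r) n) :=
  fun x y h => funext fun k => by
    have := congrFun h ⟨n - r + k, by omega⟩
    rw [fillTop_apply hr, fillTop_apply hr] at this
    exact_mod_cast this

theorem fillTop_eq_top_iff (x : Fin r → ℕ) (i : Fin n) : fillTop n x i = ⊤ ↔ ¬ n - r ≤ (i : ℕ) := by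
  unfold fillTop
  split_ifs with h <;> simp [h]

theorem fillTop_succ_le (x : Fin r → ℕ) (hx : StrictAnti x) (i j : Fin n)
    (hij : (j : ℕ) = i + 1) : fillTop n x j + 1 ≤ fillTop n x i := by
  by_cases h : n - r ≤ (i : ℕ)
  · unfold fillTop
    rw [dif_pos h, dif_pos (by omega)]
    have : x ⟨j - (n - r), by omega⟩ + 1 ≤ x ⟨i - (n - r), by omega⟩ := hx (by
      rw [Fin.lt_def]; dsimp only; omega)
    exact_mod_cast this
  · rw [(fillTop_eq_top_iff x i).2 h]
    exact le_top

theorem IsPath.start_succ_le {b N : Fin n → ℕ} {c : ℕ → Fin n → ℕ∞} (h : IsPath b N c)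
    (i j : Fin n) (hij : (j : ℕ) = i + 1) : c 0 j + 1 ≤ c 0 i :=
  (h.interlace 0 i j hij).trans (h.anti 0 i)

theorem IsPath.exists_start_eq_fillTop {b N : Fin n → ℕ} {c : ℕ → Fin n → ℕ∞} (h : IsPath b N c)
    (hr : r ≤ n) (hb : ∀ i, b i = 0 ↔ n - r ≤ (i : ℕ)) :
    ∃ x : Fin r → ℕ, StrictAnti x ∧ c 0 = fillTop n x := by
  have hne : ∀ i : Fin n, n - r ≤ (i : ℕ) → c 0 i ≠ ⊤ := fun i hi ht => by
    have h1 := (h.top_iff 0 i).1 ht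
    have h2 := (hb i).2 hi
    omega
  refine ⟨fun k => (c 0 ⟨n - r + k, by omega⟩).toNat, ?_, ?_⟩
  · cases r with
    | zero => exact fun i => i.elim0
    | succ r =>
      refine Fin.strictAnti_iff_succ_lt.2 fun k => ?_
      have h1 := h.start_succ_le ⟨n - (r + 1) + k.castSucc, by omega⟩
        ⟨n - (r + 1) + k.succ, by omega⟩ (by simp; omega)
      have h2 := hne ⟨n - (r + 1) + k.castSucc, by omega⟩ (by simp)
      have h3 := hne ⟨n - (r + 1) + k.succ, by omega⟩ (by simp)
      obtain ⟨u, hu⟩ := ENat.ne_top_iff_exists.1 h2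
      obtain ⟨v, hv⟩ := ENat.ne_top_iff_exists.1 h3
      rw [← hu, ← hv] at h1
      rw [← hu, ← hv, ENat.toNat_natCast, ENat.toNat_natCast]
      have : v + 1 ≤ u := by exact_mod_cast h1
      omega
  · funext i
    unfold fillTop
    split_ifs with hi
    · rw [ENat.natCast_toNat]
      · congr 1
        exact Fin.ext (by dsimp only; omega)
      · exact hne _ (by dsimp only; omega)
    · refine (h.top_iff 0 i).2 (Nat.pos_of_ne_zero fun h0 => hi ((hb i).1 h0))

theorem Agree.of_fillTop (hn : r ≤ n) (hm : r ≤ m) (x : Fin r → ℕ) :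
    Agree (fillTop n x) (fillTop m x) := fun i j hij => by
  unfold fillTop
  by_cases h : n - r ≤ (i : ℕ)
  · rw [dif_pos h, dif_pos (by omega)]
    congr 2
    exact Fin.ext (by dsimp only; omega)
  · rw [dif_neg h, dif_neg (by omega)]

theorem Agree.eq_of_fillTop (hn : r ≤ n) (hm : r ≤ m) {x y : Fin r → ℕ}
    (h : Agree (fillTop n x) (fillTop m y)) : x = y := funext fun k => by
  have := h ⟨n - r + k, by omega⟩ ⟨m - r + k, by omega⟩ (by dsimp only; omega)
  rw [fillTop_apply hn, fillTop_apply hm] at this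
  exact_mod_cast this

end Start

/-! ### The generating function as a sum over diagonal states. -/

section Chi

variable {n m : ℕ} {mu nu lam : YoungDiagram}

/-- Pairs of halves, sorted by the state on the common diagonal. -/
noncomputable def agreeEquiv (n m : ℕ) (mu nu lam : YoungDiagram) :
    (Σ x : {x : Fin (atyp n m lam) → ℕ // StrictAnti x},
      {p : RightPath n m nu lam // p.1 0 = fillTop n x.1}
        × {p : LeftPath n m mu lam // p.1 0 = fillTop m x.1}) ≃
    {p : RightPath n m nu lam × LeftPath n m mu lam // Agree (p.1.1 0) (p.2.1 0)} :=
  Equiv.ofBijective (fun s => ⟨(s.2.1.1, s.2.2.1), by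
      rw [s.2.1.2, s.2.2.2]
      exact Agree.of_fillTop (atyp_le_left n m lam) (atyp_le_right n m lam) _⟩) (by
    constructor
    · rintro ⟨⟨x, hx⟩, ⟨p, hp⟩, ⟨p', hp'⟩⟩ ⟨⟨y, hy⟩, ⟨u, hu⟩, ⟨u', hu'⟩⟩ h
      simp only [Subtype.mk.injEq, Prod.mk.injEq] at h
      obtain ⟨rfl, rfl⟩ := h
      obtain rfl := fillTop_injective (atyp_le_left n m lam) (hp.symm.trans hu)
      rfl
    · rintro ⟨⟨p, p'⟩, h⟩
      obtain ⟨x, hx, hpx⟩ := p.2.exists_start_eq_fillTop (atyp_le_left n m lam)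
        (birth_rowLen_eq_zero_iff n m lam)
      obtain ⟨y, hy, hpy⟩ := p'.2.exists_start_eq_fillTop (atyp_le_right n m lam)
        (birth_colLen_eq_zero_iff n m lam)
      have h' := h
      dsimp only at h'
      rw [hpx, hpy] at h'
      obtain rfl := Agree.eq_of_fillTop (atyp_le_left n m lam) (atyp_le_right n m lam) h'
      exact ⟨⟨⟨x, hx⟩, ⟨p, hpx⟩, ⟨p', hpy⟩⟩, rfl⟩)

theorem toNat_le_excess_add (N : Fin n → ℕ) (Y : Fin n → ℕ∞) (i : Fin n) :
    (Y i).toNat ≤ excess N Y + ∑ i, N i := by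
  have h1 := Finset.single_le_sum (f := fun i => (Y i).toNat - N i) (fun _ _ => Nat.zero_le _)
    (Finset.mem_univ i)
  have h2 := Finset.single_le_sum (f := N) (fun _ _ => Nat.zero_le _) (Finset.mem_univ i)
  unfold excess
  omega

/-- The weight omits the diagonal of the left half, while finiteness of paths needs a bound on it.
Agreement with the right half supplies one: each of the `m` terms is bounded by a right-hand
position. -/
theorem excess_le_of_agree (p : RightPath n m nu lam) (p' : LeftPath n m mu lam)
    (h : Agree (p.1 0) (p'.1 0)) : excess (shiftedPart m mu.rowLen) (p'.1 0)
      ≤ m * (excess (shiftedPart n nu.rowLen) (p.1 0) + ∑ i, shiftedPart n nu.rowLen i) := by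
  have h1 : ∀ j, (p'.1 0 j).toNat - shiftedPart m mu.rowLen j
      ≤ excess (shiftedPart n nu.rowLen) (p.1 0) + ∑ i, shiftedPart n nu.rowLen i := fun j => by
    refine (Nat.sub_le _ _).trans ?_
    by_cases ht : p'.1 0 j = ⊤
    · simp [ht]
    · have hb : birth m n lam.colLen j = 0 := by
        by_contra hb
        exact ht ((p'.2.top_iff 0 j).2 (Nat.pos_of_ne_zero hb))
      have hj := (birth_colLen_eq_zero_iff n m lam j).1 hb
      have hr := atyp_le_left n m lam
      have hj' := j.2
      rw [← h ⟨n - (m - j), by omega⟩ j (by dsimp only; omega)]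
      exact toNat_le_excess_add _ _ _
  refine (Finset.sum_le_sum fun j _ => h1 j).trans ?_
  rw [Finset.sum_const, Finset.card_univ, Fintype.card_fin, smul_eq_mul]

theorem summable_weight (hnu : nu.colLen 0 ≤ n) (hmu : mu.colLen 0 ≤ m)
    (hlam : lam.rowLen n < m + 1) :
    Summable fun a : PlanePartition n m mu nu lam => qpow a.weight := by
  refine summable_qpow fun D => ?_
  refine Set.Finite.of_finite_image (f := fun a => (a.right, a.left))
    (((Path.finite_setOf_finsum_excess_le _ _ D.toNat).prod
      (Path.finite_setOf_finsum_excess_le _ _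
        (m * (D.toNat + ∑ i, shiftedPart n nu.rowLen i) + D.toNat))).subset ?_) ?_
  · rintro _ ⟨a, ha, rfl⟩
    simp only [Set.mem_ofPred_eq] at ha
    rw [a.weight_eq] at ha
    have h1 := excess_le_of_agree _ _ a.agree
    have h2 : m * (excess (shiftedPart n nu.rowLen) (a.right.1 0) + ∑ i, shiftedPart n nu.rowLen i)
        ≤ m * (D.toNat + ∑ i, shiftedPart n nu.rowLen i) :=
      Nat.mul_le_mul_left _ (by omega)
    refine ⟨?_, ?_⟩
    · simp only [Set.mem_ofPred_eq]
      rw [finsum_excess_eq_add a.right.2]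
      omega
    · simp only [Set.mem_ofPred_eq]
      rw [finsum_excess_eq_add a.left.2]
      omega
  · intro a _ a' _ h
    exact (halvesEquiv hnu hmu hlam).injective (Subtype.ext h)

theorem weight_nonneg (a : PlanePartition n m mu nu lam) : 0 ≤ a.weight := by
  rw [a.weight_eq]; positivity

theorem hasSum_chi (hnu : nu.colLen 0 ≤ n) (hmu : mu.colLen 0 ≤ m)
    (hlam : lam.rowLen n < m + 1) :
    HasSum (fun a : PlanePartition n m mu nu lam => qpow a.weight) (chi n m mu nu lam) := by
  have h := summable_weight hnu hmu hlam
  suffices hs : ∑' a : PlanePartition n m mu nu lam, qpow a.weight = chi n m mu nu lam by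
    rw [← hs]; exact h.hasSum
  ext d
  have hset : {a : PlanePartition n m mu nu lam | (qpow a.weight).coeff d ≠ 0}
      = {a | a.weight = d} := by
    ext a
    simp only [Set.mem_ofPred_eq, qpow]
    constructor
    · intro h1
      by_contra h2
      exact h1 (HahnSeries.coeff_single_of_ne (Ne.symm h2))
    · rintro rfl
      simp
  have hfin : {a : PlanePartition n m mu nu lam | (qpow a.weight).coeff d ≠ 0}.Finite := by
    rw [hset]
    exact (finite_of_summable_qpow h (d + 1)).subset fun a ha => by
      simp only [Set.mem_ofPred_eq] at *
      omega
  rw [HasSum.coeff_eq h.hasSum d hfin]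
  rcases lt_or_ge d 0 with hd | hd
  · rw [chi, orderGE_zero_mem_of_ofPowerSeries _ d hd]
    refine Finset.sum_eq_zero fun a ha => ?_
    have : a.weight = d := by
      rw [Set.Finite.mem_toFinset, hset] at ha
      exact ha
    have := weight_nonneg a
    omega
  · lift d to ℕ using hd
    rw [chi, HahnSeries.ofPowerSeries_apply_coeff, PowerSeries.coeff_mk]
    rw [Finset.sum_congr rfl (g := fun _ => (1 : ℚ))]
    · rw [Finset.sum_const, nsmul_eq_mul, mul_one, ← Set.ncard_eq_toFinset_card _ hfin, hset]
      rfl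
    · intro a ha
      have : a.weight = d := by
        rw [Set.Finite.mem_toFinset, hset] at ha
        exact ha
      rw [this]
      simp [qpow]

/-- The truncated and exact exponents can differ only when some `X i < N i`, and then no path starts
at `X`. -/
theorem qpow_excess_mul_pathGF (b N : Fin n → ℕ) (X : Fin n → ℕ∞) :
    qpow (excess N X) * pathGF b N X = qpow (excessInt N X) * pathGF b N X := by
  by_cases h : ∀ i, (N i : ℕ∞) ≤ X i
  · rw [excessInt_eq h]
  · rw [pathGF_eq_zero, mul_zero, mul_zero]
    rintro c hc rfl
    exact h (hc.le 0)

/-- The generating function of plane partitions as a sum over the state on the diagonal. -/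
theorem hasSum_chi_diagonal (hnu : nu.colLen 0 ≤ n) (hmu : mu.colLen 0 ≤ m)
    (hlam : lam.rowLen n < m + 1) :
    HasSum (fun x : {x : Fin (atyp n m lam) → ℕ // StrictAnti x} =>
      qpow (excessInt (shiftedPart n nu.rowLen) (fillTop n x.1))
        * pathDet (birth n m lam.rowLen) (shiftedPart n nu.rowLen) (fillTop n x.1)
        * pathDet (birth m n lam.colLen) (shiftedPart m mu.rowLen) (fillTop m x.1))
      (chi n m mu nu lam) := by
  have h := hasSum_chi hnu hmu hlam
  rw [← ((agreeEquiv n m mu nu lam).trans (halvesEquiv hnu hmu hlam).symm).hasSum_iff] at h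
  refine h.sigma fun x => ?_
  have hR : pathGF (birth n m lam.rowLen) (shiftedPart n nu.rowLen) (fillTop n x.1)
      = pathDet (birth n m lam.rowLen) (shiftedPart n nu.rowLen) (fillTop n x.1) :=
    pathGF_eq_pathDet (shiftedPart_strictAnti (rowLen_antitone nu))
      (fun i => by rw [fillTop_eq_top_iff, ← birth_rowLen_eq_zero_iff, Nat.pos_iff_ne_zero])
      (fillTop_succ_le x.1 x.2) fun i j => birth_lt_birth (rowLen_antitone lam) i j
  have hL : pathGF (birth m n lam.colLen) (shiftedPart m mu.rowLen) (fillTop m x.1)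
      = pathDet (birth m n lam.colLen) (shiftedPart m mu.rowLen) (fillTop m x.1) :=
    pathGF_eq_pathDet (shiftedPart_strictAnti (rowLen_antitone mu))
      (fun i => by rw [fillTop_eq_top_iff, ← birth_colLen_eq_zero_iff, Nat.pos_iff_ne_zero])
      (fillTop_succ_le x.1 x.2) fun i j => birth_lt_birth (colLen_antitone lam) i j
  rw [← hR, ← qpow_excess_mul_pathGF, ← hL]
  -- Once the diagonal is fixed the halves are independent, so the inner sum is a product.
  have h1 := ((Path.summable_start (birth n m lam.rowLen) (shiftedPart n nu.rowLen)
    (fillTop n x.1)).hasSum.mul_left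
    (qpow (excess (shiftedPart n nu.rowLen) (fillTop n x.1)))).mul_of_nonarchimedean
    (Path.summable_start (birth m n lam.colLen) (shiftedPart m mu.rowLen) (fillTop m x.1)).hasSum
  refine (congrArg (fun f => HasSum f _) (funext fun p => ?_)).mpr h1
  set a := ((agreeEquiv n m mu nu lam).trans (halvesEquiv hnu hmu hlam).symm) ⟨x, p⟩ with ha
  have ha' : halvesEquiv hnu hmu hlam a = agreeEquiv n m mu nu lam ⟨x, p⟩ := by
    rw [ha]; simp
  have hr : a.right = p.1.1 := congrArg (fun q => q.1.1) ha'
  have hl : a.left = p.2.1 := congrArg (fun q => q.1.2) ha'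
  change qpow a.weight = _
  rw [a.weight_eq, hr, hl, p.1.2, Nat.cast_add, Nat.cast_add, qpow_add, qpow_add]

end Chi

end PitPartition

namespace PitPartition

/-! ### The path determinants in bordered form. -/

section Rotated

variable {n r : ℕ}

/-- The rows of the determinants that belong to the particles at infinity. -/
noncomputable def exponentRow {n : ℕ} (N : Fin n → ℕ) (e : ℤ) (l : Fin n) : LaurentSeries ℚ :=
  qpow (-e * N l)

theorem sum_univ_split_last {M : Type*} [AddCommMonoid M] (hr : r ≤ n) (f : Fin n → M) :
    ∑ i, f i = (∑ k : Fin (n - r), f ⟨k, by omega⟩) + ∑ k : Fin r, f ⟨n - r + k, by omega⟩ := by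
  obtain ⟨d, rfl⟩ := Nat.exists_eq_add_of_le' hr
  rw [Fin.sum_univ_add]
  congr 1
  · exact Fintype.sum_equiv (finCongr (by omega)) _ _ fun k => rfl
  · refine Finset.sum_congr rfl fun k _ => ?_
    congr 1
    exact Fin.ext (by simp)

theorem prod_dite_top (hr : r ≤ n) (c : LaurentSeries ℚ) :
    ∏ i : Fin n, (if n - r ≤ (i : ℕ) then 1 else c) = c ^ (n - r) := by
  rw [Finset.prod_ite, Finset.prod_const_one, one_mul, Finset.prod_const]
  congr 1
  rw [show (Finset.univ.filter fun i : Fin n => ¬ n - r ≤ (i : ℕ))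
    = Finset.univ.filter fun i : Fin n => (i : ℕ) < n - r by ext i; simp only [not_le]]
  rw [Fin.card_filter_val_lt]
  omega

/-- The generating function of the paths starting at `fillTop n x`, with the rows of the
determinant reordered. -/
theorem pathDet_fillTop (hr : r ≤ n) {b : Fin n → ℕ} (hb : ∀ i, b i = 0 ↔ n - r ≤ (i : ℕ))
    (N : Fin n → ℕ) (x : Fin r → ℕ) :
    pathDet b N (fillTop n x) = (-1) ^ (r * (n - 1))
      * qpow (∑ k : Fin (n - r), ((b ⟨k, by omega⟩ : ℤ) - 1) * N ⟨k, by omega⟩)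
      * qInf⁻¹ ^ (n - r)
      * (bordered (fun k l => invFac (x k) (N l))
        (fun k => exponentRow N ((b ⟨k, by omega⟩ : ℤ) - 1))).det := by
  -- Each of the `n - r` rows at infinity carries a factor `1/(q)_∞`, which is pulled out of the
  -- determinant.
  have h1 : pathMatrix b N (fillTop n x) = Matrix.of fun (i l : Fin n) =>
      (if n - r ≤ (i : ℕ) then 1 else qInf⁻¹) * (Matrix.of fun i l : Fin n =>
        if h : n - r ≤ (i : ℕ) then invFac (x ⟨i - (n - r), by omega⟩) (N l)
        else exponentRow N ((b ⟨i, by omega⟩ : ℤ) - 1) l) i l := by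
    ext1 i l
    simp only [pathMatrix, Matrix.of_apply, fillTop]
    by_cases h : n - r ≤ (i : ℕ)
    · have h0 : ((b i - 1 : ℕ) : ℤ) = 0 := by rw [(hb i).2 h]; rfl
      simp [h, h0]
    · have h0 : ((b i - 1 : ℕ) : ℤ) = (b i : ℤ) - 1 := by
        have : b i ≠ 0 := fun h' => h ((hb i).1 h')
        omega
      simp only [h, dite_false, if_false, invFacTop_top, h0, exponentRow]
      ring
  have h2 : ∑ i, ((b i - 1 : ℕ) : ℤ) * N i
      = ∑ k : Fin (n - r), ((b ⟨k, by omega⟩ : ℤ) - 1) * N ⟨k, by omega⟩ := by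
    rw [sum_univ_split_last hr, Finset.sum_eq_zero (s := (Finset.univ : Finset (Fin r))), add_zero]
    · refine Finset.sum_congr rfl fun k _ => ?_
      have : b ⟨k, by omega⟩ ≠ 0 := fun h' => by
        have h3 : n - r ≤ (k : ℕ) := (hb _).1 h'
        omega
      congr 1
      omega
    · intro k _
      rw [(hb _).2 (by dsimp only; omega)]
      simp
  rw [pathDet, h2, h1, Matrix.det_mul_column, prod_dite_top hr,
    det_rotate hr (fun k l => invFac (x k) (N l))
      (fun k => exponentRow N ((b ⟨k, by omega⟩ : ℤ) - 1))]
  ring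

/-- The diagonal weight is absorbed by scaling rows by `q^{x_k}` and columns by `q^{-N_l}`. The
column scaling raises the exponents at infinity by one. Only the right half carries this weight,
hence the asymmetry between `P + 1` and `Q` in the formula. -/
theorem det_bordered_mul_qpow (N : Fin n → ℕ) (x : Fin r → ℕ) (e : Fin (n - r) → ℤ) (hr : r ≤ n) :
    qpow (∑ k, (x k : ℤ)) * (bordered (fun k l => invFac (x k) (N l))
        (fun k => exponentRow N (e k - 1))).det
      = qpow (∑ l, (N l : ℤ)) * (bordered (fun k l => qpow ((x k : ℤ) - N l) * invFac (x k) (N l))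
        (fun k => exponentRow N (e k))).det := by
  have h1 : bordered (fun k l => qpow ((x k : ℤ) - N l) * invFac (x k) (N l))
      (fun k => exponentRow N (e k)) = Matrix.of fun (i l : Fin n) =>
        qpow (if h : (i : ℕ) < r then (x ⟨i, h⟩ : ℤ) else 0) * (Matrix.of fun i l =>
          qpow (-(N l : ℤ)) * bordered (fun k l => invFac (x k) (N l))
            (fun k => exponentRow N (e k - 1)) i l) i l := by
    ext1 i l
    simp only [bordered, Matrix.of_apply, exponentRow]
    split_ifs with h
    · rw [← mul_assoc, ← qpow_add, sub_eq_add_neg]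
    · rw [← qpow_add, ← qpow_add]
      congr 1
      ring
  have h2 : ∑ i : Fin n, (if h : (i : ℕ) < r then (x ⟨i, h⟩ : ℤ) else 0) = ∑ k, (x k : ℤ) := by
    have := prod_univ_split (M := Multiplicative ℤ) hr
      (fun i => Multiplicative.ofAdd (if h : (i : ℕ) < r then (x ⟨i, h⟩ : ℤ) else 0))
    simp only [← ofAdd_sum] at this
    have h3 := Multiplicative.ofAdd.injective this
    rw [h3]
    simp
  rw [h1, Matrix.det_mul_column, Matrix.det_mul_row, ← qpow_sum, ← qpow_sum, h2, ← mul_assoc,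
    ← mul_assoc, ← qpow_add, ← qpow_add, Finset.sum_neg_distrib]
  congr 2
  ring

theorem excessInt_fillTop (hr : r ≤ n) (N : Fin n → ℕ) (x : Fin r → ℕ) :
    excessInt N (fillTop n x) = (∑ k, (x k : ℤ)) - ∑ l, (N l : ℤ)
      + ∑ k : Fin (n - r), (N ⟨k, by omega⟩ : ℤ) := by
  rw [excessInt, sum_univ_split_last hr, sum_univ_split_last hr (fun l => (N l : ℤ)),
    Finset.sum_eq_zero (s := (Finset.univ : Finset (Fin (n - r))))]
  · rw [zero_add, Finset.sum_congr rfl (g := fun k : Fin r =>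
      (x k : ℤ) - N ⟨n - r + k, by omega⟩), Finset.sum_sub_distrib]
    · ring
    · intro k _
      rw [fillTop_apply hr, if_neg (by simp), ENat.toNat_natCast]
  · intro k _
    rw [if_pos ((fillTop_eq_top_iff x _).2 (by dsimp only; omega))]

/-- The generating function of the right halves, the diagonal included. -/
theorem qpow_excessInt_mul_pathDet_fillTop (hr : r ≤ n) {b : Fin n → ℕ}
    (hb : ∀ i, b i = 0 ↔ n - r ≤ (i : ℕ)) (N : Fin n → ℕ) (x : Fin r → ℕ) :
    qpow (excessInt N (fillTop n x)) * pathDet b N (fillTop n x) = (-1) ^ (r * (n - 1))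
      * qpow (∑ k : Fin (n - r), (b ⟨k, by omega⟩ : ℤ) * N ⟨k, by omega⟩)
      * qInf⁻¹ ^ (n - r)
      * (bordered (fun k l => qpow ((x k : ℤ) - N l) * invFac (x k) (N l))
        (fun k => exponentRow N (b ⟨k, by omega⟩))).det := by
  have h1 := det_bordered_mul_qpow N x (fun k => (b ⟨k, by omega⟩ : ℤ)) hr
  rw [pathDet_fillTop hr hb, excessInt_fillTop hr]
  have h2 : (∑ k : Fin (n - r), (b ⟨k, by omega⟩ : ℤ) * N ⟨k, by omega⟩)
      = (∑ k : Fin (n - r), ((b ⟨k, by omega⟩ : ℤ) - 1) * N ⟨k, by omega⟩)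
        + ∑ k : Fin (n - r), (N ⟨k, by omega⟩ : ℤ) := by
    rw [← Finset.sum_add_distrib]
    exact Finset.sum_congr rfl fun k _ => by ring
  rw [h2, sub_eq_add_neg, qpow_add, qpow_add, qpow_add]
  have h3 : qpow (-∑ l, (N l : ℤ)) * qpow (∑ l, (N l : ℤ)) = 1 := by
    rw [← qpow_add, neg_add_cancel, qpow_zero]
  linear_combination ((-1) ^ (r * (n - 1)) * qpow (-∑ l, (N l : ℤ))
    * qpow (∑ k : Fin (n - r), ((b ⟨k, by omega⟩ : ℤ) - 1) * N ⟨k, by omega⟩)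
    * qpow (∑ k : Fin (n - r), (N ⟨k, by omega⟩ : ℤ)) * qInf⁻¹ ^ (n - r)) * h1
    + ((-1) ^ (r * (n - 1))
    * qpow (∑ k : Fin (n - r), ((b ⟨k, by omega⟩ : ℤ) - 1) * N ⟨k, by omega⟩)
    * qpow (∑ k : Fin (n - r), (N ⟨k, by omega⟩ : ℤ)) * qInf⁻¹ ^ (n - r)
    * (bordered (fun k l => qpow ((x k : ℤ) - N l) * invFac (x k) (N l))
        (fun k => exponentRow N (b ⟨k, by omega⟩))).det) * h3

end Rotated

end PitPartition

namespace PitPartition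

/-! ### Complementary edge labels of the boundary of `λ`. -/

section MayaDiagram

variable {n m : ℕ} {lam : YoungDiagram}

/-- The first `n - r` particles start at infinity, so the subtraction in `birth` is not truncated.
-/
theorem P_add_one_eq (n m : ℕ) (lam : YoungDiagram) (k : Fin (n - atyp n m lam)) :
    P n m lam k + 1 = birth n m lam.rowLen ⟨k, by omega⟩ := by
  have h : birth n m lam.rowLen ⟨k, by omega⟩ ≠ 0 := fun h => by
    have h1 : n - atyp n m lam ≤ (k : ℕ) := (birth_rowLen_eq_zero_iff n m lam _).1 h
    omega
  unfold birth at *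
  unfold P piPart
  dsimp only at *
  omega

theorem Q_eq (n m : ℕ) (lam : YoungDiagram) (k : Fin (m - atyp n m lam)) :
    Q n m lam k = birth m n lam.colLen ⟨k, by omega⟩ - 1 := by
  have h : birth m n lam.colLen ⟨k, by omega⟩ ≠ 0 := fun h => by
    have h1 : m - atyp n m lam ≤ (k : ℕ) := (birth_colLen_eq_zero_iff n m lam _).1 h
    omega
  unfold birth at *
  unfold Q kappaPart
  dsimp only at *
  omega

theorem N_eq (nu : YoungDiagram) (l : Fin n) : N n nu l = shiftedPart n nu.rowLen l := by
  unfold N shiftedPart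
  omega

theorem M_eq (mu : YoungDiagram) (l : Fin m) : M m mu l = shiftedPart m mu.rowLen l := by
  unfold M shiftedPart
  omega

theorem neg_L_eq (n m : ℕ) (lam : YoungDiagram) (s : ℕ) :
    -L n m lam s = s - lam.rowLen s + m - n := by
  unfold L
  ring

theorem neg_L_strictMono (n m : ℕ) (lam : YoungDiagram) :
    StrictMono fun s => -L n m lam s := fun s t hst => by
  have := rowLen_antitone lam hst.le
  dsimp only
  rw [neg_L_eq, neg_L_eq]
  omega

theorem neg_L_nonneg (hlam : lam.rowLen n < m + 1) {s : ℕ} (hs : n - atyp n m lam ≤ s) :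
    0 ≤ -L n m lam s := by
  rw [neg_L_eq]
  rcases lt_or_ge s n with h | h
  · have h1 := (birth_rowLen_eq_zero_iff n m lam ⟨s, h⟩).2 hs
    unfold birth at h1
    dsimp only at h1
    omega
  · have := rowLen_antitone lam h
    omega

/-- The difference `Q_j - (-L_s)` is the signed hook length of the box `(s, j)`: at least one inside
`λ`, at most minus one outside, never zero. -/
theorem neg_L_ne_Q (n m : ℕ) (lam : YoungDiagram) (s : ℕ) (j : Fin (m - atyp n m lam)) :
    -L n m lam s ≠ Q n m lam j := by
  have hr := atyp_le_left n m lam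
  have hr' := atyp_le_right n m lam
  rw [neg_L_eq]
  unfold Q kappaPart
  by_cases h : (s, (j : ℕ)) ∈ lam
  · have h1 := YoungDiagram.mem_iff_lt_rowLen.1 h
    have h2 := YoungDiagram.mem_iff_lt_colLen.1 h
    omega
  · have h1 : ¬ (j : ℕ) < lam.rowLen s := fun h' => h (YoungDiagram.mem_iff_lt_rowLen.2 h')
    have h2 : ¬ s < lam.colLen j := fun h' => h (YoungDiagram.mem_iff_lt_colLen.2 h')
    omega

/-- The labels of rows and columns together exhaust the boundary. For the least `s` with `-L_s ≥ A`,
either equality holds or `A` labels a column, which is excluded by hypothesis. -/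
theorem exists_neg_L_eq (hlam : lam.rowLen n < m + 1) (A : ℕ)
    (hA : ∀ j : Fin (m - atyp n m lam), (A : ℤ) ≠ Q n m lam j) :
    ∃ s, n - atyp n m lam ≤ s ∧ -L n m lam s = A := by
  have hr := atyp_le_left n m lam
  have hr' := atyp_le_right n m lam
  have hex : ∃ s, (A : ℤ) ≤ -L n m lam s := by
    refine ⟨A + n + lam.rowLen 0, ?_⟩
    have := rowLen_antitone lam (Nat.zero_le (A + n + lam.rowLen 0))
    rw [neg_L_eq]
    omega
  classical
  have hs := Nat.find_spec hex
  have hmin : ∀ t, t + 1 = Nat.find hex → -L n m lam t < A := fun t ht =>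
    not_le.1 (Nat.find_min hex (by omega))
  generalize Nat.find hex = s at hs hmin
  have heq : -L n m lam s = A := by
    by_contra hne
    rw [neg_L_eq] at hs hne
    -- The column solving `Q_j = A` if its length is `s`; minimality of `s` gives that length.
    obtain ⟨j, hj⟩ : ∃ j : ℕ, (j : ℤ) = s - (A + n - m) - 1 := ⟨_, Int.toNat_of_nonneg (by omega)⟩
    have h1 : (s, j) ∉ lam := fun h => by
      have := YoungDiagram.mem_iff_lt_rowLen.1 h
      omega
    have h2 : ¬ s < lam.colLen j := fun h => h1 (YoungDiagram.mem_iff_lt_colLen.2 h)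
    have h3 : s ≤ lam.colLen j := by
      cases s with
      | zero => exact Nat.zero_le _
      | succ t =>
        have h4 := hmin t rfl
        rw [neg_L_eq] at h4
        have h5 : (t, j) ∈ lam := YoungDiagram.mem_iff_lt_rowLen.2 (by omega)
        exact YoungDiagram.mem_iff_lt_colLen.1 h5
    have hjm : j < m - atyp n m lam := by
      by_contra hjm
      rcases lt_or_ge j m with h | h
      · have h6 := (birth_colLen_eq_zero_iff n m lam ⟨j, h⟩).2 (by dsimp only; omega)
        unfold birth at h6
        dsimp only at h6
        omega
      · have h6 : (n, j) ∈ lam := YoungDiagram.mem_iff_lt_colLen.2 (by omega)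
        have h7 := YoungDiagram.mem_iff_lt_rowLen.1 h6
        omega
    refine hA ⟨j, hjm⟩ ?_
    unfold Q kappaPart
    dsimp only
    omega
  refine ⟨s, ?_, heq⟩
  -- Rows before `n - r` have positive birth time, which means `-L_s < 0`, whereas `A ≥ 0`.
  by_contra hlt
  have h1 : birth n m lam.rowLen ⟨s, by omega⟩ ≠ 0 := fun h => by
    have h1 : n - atyp n m lam ≤ s := (birth_rowLen_eq_zero_iff n m lam _).1 h
    omega
  unfold birth at h1
  dsimp only at h1
  rw [neg_L_eq] at heq
  omega

end MayaDiagram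

end PitPartition

namespace PitPartition

/-! ### Cauchy-Binet backwards, with vanishing terms removed. -/

section Expansion

variable {n m r : ℕ}

theorem summable_prod_of_fintype {W X : Type*} [Finite W] {F : W × X → LaurentSeries ℚ}
    (h : ∀ w, Summable fun x => F (w, x)) : Summable F :=
  summable_iff_orderGE.2 fun D =>
    (Set.finite_iUnion fun w => (summable_iff_orderGE.1 (h w) D).image (Prod.mk w)).subset
      fun y hy => Set.mem_iUnion.2 ⟨y.1, y.2, hy, rfl⟩

theorem hasSum_sum_of_hasSum_prod {W X : Type*} [Fintype W] {F : W × X → LaurentSeries ℚ}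
    {S : LaurentSeries ℚ} (h : HasSum F S) : HasSum (fun x => ∑ w, F (w, x)) S :=
  HasSum.prod_fiberwise (f := fun y : X × W => F (y.2, y.1))
    ((Equiv.prodComm X W).hasSum_iff.2 h) fun _ => hasSum_fintype _

/-- For a tuple outside `p` the individual terms need not vanish; only their sum over the
permutations does, as a determinant with a repeated row. So the restricted family is first shown
summable over permutations and tuples jointly, then grouped by tuple and compared with the full sum.
-/
theorem hasSum_borderedPairing_expand (hn : r ≤ n) (hm : r ≤ m)
    {f : ℕ → Fin n → LaurentSeries ℚ} {g : ℕ → Fin m → LaurentSeries ℚ}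
    {H : Fin n → Fin m → LaurentSeries ℚ}
    (hH : ∀ l l', HasSum (fun x => f x l * g x l') (H l l'))
    (bot : Fin (n - r) → Fin n → LaurentSeries ℚ)
    (bot' : Fin (m - r) → Fin m → LaurentSeries ℚ) {p : (Fin r → ℕ) → Prop}
    (hp : ∀ x, ¬ p x → ∃ k j, g (x k) = bot' j) :
    HasSum (fun y : (Equiv.Perm (Fin n) × Equiv.Perm (Fin m))
          × {x : Fin r → ℕ // StrictAnti x ∧ p x} =>
        ((Equiv.Perm.sign y.1.1 : ℤ) : LaurentSeries ℚ)
          * ((Equiv.Perm.sign y.1.2 : ℤ) : LaurentSeries ℚ)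
          * (∏ k : Fin (n - r), bot k (y.1.1 ⟨r + k, Nat.add_lt_of_lt_sub' k.isLt⟩))
          * (∏ k : Fin (m - r), bot' k (y.1.2 ⟨r + k, Nat.add_lt_of_lt_sub' k.isLt⟩))
          * ∏ k : Fin r, f (y.2.1 k) (y.1.1 (k.castLE hn)) * g (y.2.1 k) (y.1.2 (k.castLE hm)))
      ((r.factorial : LaurentSeries ℚ)⁻¹ * borderedPairing hn hm bot bot' H) := by
  let G : (Equiv.Perm (Fin n) × Equiv.Perm (Fin m)) → (Fin r → ℕ) → LaurentSeries ℚ := fun w x =>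
    ((Equiv.Perm.sign w.1 : ℤ) : LaurentSeries ℚ) * ((Equiv.Perm.sign w.2 : ℤ) : LaurentSeries ℚ)
      * (∏ k : Fin (n - r), bot k (w.1 ⟨r + k, Nat.add_lt_of_lt_sub' k.isLt⟩))
      * (∏ k : Fin (m - r), bot' k (w.2 ⟨r + k, Nat.add_lt_of_lt_sub' k.isLt⟩))
      * ∏ k : Fin r, f (x k) (w.1 (k.castLE hn)) * g (x k) (w.2 (k.castLE hm))
  let F : (Equiv.Perm (Fin n) × Equiv.Perm (Fin m)) × {x : Fin r → ℕ // StrictAnti x ∧ p x} →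
    LaurentSeries ℚ := fun y => G y.1 y.2.1
  have hG : ∀ w, Summable (G w) := fun w =>
    (hasSum_pi_prod fun k : Fin r =>
      hH (w.1 (k.castLE hn)) (w.2 (k.castLE hm))).summable.mul_left _
  have hslice : ∀ w, Summable fun x => F (w, x) := fun w =>
    (hG w).comp_injective Subtype.val_injective
  have hsum : Summable F := summable_prod_of_fintype hslice
  have h1 : HasSum (fun x : {x : Fin r → ℕ // StrictAnti x ∧ p x} =>
      (bordered (fun k => f (x.1 k)) bot).det * (bordered (fun k => g (x.1 k)) bot').det)
      (∑' y, F y) := by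
    refine (congrArg (fun f => HasSum f _) (funext fun x => ?_)).mpr
      (hasSum_sum_of_hasSum_prod hsum.hasSum)
    rw [det_bordered_mul_det_bordered hn hm, Fintype.sum_prod_type]
  have h2 := hasSum_det_bordered_mul hn hm hH bot bot'
  let ι : {x : Fin r → ℕ // StrictAnti x ∧ p x} → {x : Fin r → ℕ // StrictAnti x} :=
    fun x => ⟨x.1, x.2.1⟩
  have hι : Function.Injective ι := fun x y h => Subtype.ext (congrArg (fun z => z.1) h)
  rw [← hι.hasSum_iff] at h2
  · rw [← h1.unique h2]
    exact hsum.hasSum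
  · intro x hx
    obtain ⟨k, j, h⟩ := hp x.1 fun h => hx ⟨⟨x.1, x.2, h⟩, rfl⟩
    rw [det_bordered_eq_zero_of_eq hm h, mul_zero]

end Expansion

/-! ### The index set `Θ` and the bosonic formula. -/

section ThetaSum

variable {n m : ℕ} {mu nu lam : YoungDiagram}

theorem Theta.ext' {θ θ' : Theta n m lam} (h1 : θ.sigma = θ'.sigma) (h2 : θ.tau = θ'.tau)
    (h3 : θ.s = θ'.s) : θ = θ' := by
  cases θ
  cases θ'
  simp only at h1 h2 h3
  subst h1 h2 h3
  rfl

theorem Theta.A_nonneg (hlam : lam.rowLen n < m + 1) (θ : Theta n m lam)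
    (i : Fin (atyp n m lam)) : 0 ≤ θ.A i :=
  neg_L_nonneg hlam (θ.le_s _)

theorem Theta.toNat_A (hlam : lam.rowLen n < m + 1) (θ : Theta n m lam)
    (i : Fin (atyp n m lam)) : ((θ.A i).toNat : ℤ) = θ.A i :=
  Int.toNat_of_nonneg (θ.A_nonneg hlam i)

/-- A triple of `Θ` is determined by the two permutations and the exponents `A`, which are the
strictly decreasing sequences of natural numbers avoiding the `Q_j`. -/
noncomputable def thetaEquiv (hlam : lam.rowLen n < m + 1) :
    Theta n m lam ≃ (Equiv.Perm (Fin n) × Equiv.Perm (Fin m))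
      × {A : Fin (atyp n m lam) → ℕ // StrictAnti A ∧
        ∀ k, ∀ j : Fin (m - atyp n m lam), (A k : ℤ) ≠ Q n m lam j} :=
  Equiv.ofBijective (fun θ => ((θ.sigma, θ.tau), ⟨fun i => (θ.A i).toNat, by
      refine ⟨fun i j hij => ?_, fun k j => ?_⟩
      · have h := neg_L_strictMono n m lam (θ.s_strictMono (Fin.rev_lt_rev.2 hij))
        have h1 := θ.toNat_A hlam i
        have h2 := θ.toNat_A hlam j
        unfold Theta.A at *
        dsimp only at *
        omega
      · rw [θ.toNat_A hlam]
        exact neg_L_ne_Q n m lam _ j⟩)) <| by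
    constructor
    · intro θ θ' h
      obtain ⟨h12, h3⟩ := Prod.mk.inj h
      obtain ⟨h1, h2⟩ := Prod.mk.inj h12
      refine Theta.ext' h1 h2 (funext fun i => (neg_L_strictMono n m lam).injective ?_)
      have h4 := congrFun (Subtype.mk.inj h3) i.rev
      have h5 := θ.toNat_A hlam i.rev
      have h6 := θ'.toNat_A hlam i.rev
      rw [h4, h6] at h5
      unfold Theta.A at h5
      rw [Fin.rev_rev] at h5
      exact h5.symm
    · rintro ⟨⟨σ, τ⟩, A, hA, hQ⟩
      -- Since `-L` is strictly increasing, the decreasing tuple `A` has to be read backwards to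
      -- give increasing `s`.
      choose s hs1 hs2 using fun k => exists_neg_L_eq hlam (A k) (hQ k)
      have hmono : StrictMono fun i : Fin (atyp n m lam) => s i.rev := fun i j hij => by
        refine (neg_L_strictMono n m lam).lt_iff_lt.1 ?_
        dsimp only
        rw [hs2, hs2]
        exact_mod_cast hA (Fin.rev_lt_rev.2 hij)
      refine ⟨⟨σ, τ, fun i => s i.rev, hmono, fun i => hs1 _⟩, ?_⟩
      refine Prod.ext rfl (Subtype.ext (funext fun i => ?_))
      have : -L n m lam (s i.rev.rev) = A i := by rw [Fin.rev_rev, hs2]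
      exact (congrArg Int.toNat this).trans (Int.toNat_natCast _)

/-- `∑_{A ≥ 0} (-1)^A q^{A(A+1)/2 + A d}`. -/
noncomputable def partialTheta (d : ℤ) : LaurentSeries ℚ :=
  ∑' A : ℕ, (-1) ^ (A : ℤ) * qpow ((A : ℤ) * (A + 1) / 2 + A * d)

/-- The common factor of the summands of the bosonic formula. -/
noncomputable def bosonicFactor (n m : ℕ) (mu nu lam : YoungDiagram) : LaurentSeries ℚ :=
  qpow (∑ k : Fin (n - atyp n m lam), (P n m lam k + 1) * N n nu k)
    * qpow (∑ k : Fin (m - atyp n m lam), Q n m lam k * M m mu k) * qInf⁻¹ ^ (n + m)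

theorem Theta.term_eq (hlam : lam.rowLen n < m + 1) (θ : Theta n m lam) :
    θ.term mu nu = bosonicFactor n m mu nu lam *
      (((Equiv.Perm.sign θ.sigma : ℤ) : LaurentSeries ℚ)
        * ((Equiv.Perm.sign θ.tau : ℤ) : LaurentSeries ℚ)
        * (∏ k : Fin (n - atyp n m lam), exponentRow (shiftedPart n nu.rowLen) (P n m lam k + 1)
          (θ.sigma ⟨atyp n m lam + k, Nat.add_lt_of_lt_sub' k.isLt⟩))
        * (∏ k : Fin (m - atyp n m lam), exponentRow (shiftedPart m mu.rowLen) (Q n m lam k)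
          (θ.tau ⟨atyp n m lam + k, Nat.add_lt_of_lt_sub' k.isLt⟩))
        * ∏ k : Fin (atyp n m lam),
          ((-1) ^ ((θ.A k).toNat : ℤ) * qpow (((θ.A k).toNat : ℤ) * ((θ.A k).toNat + 1) / 2
              + (θ.A k).toNat * shiftedPart n nu.rowLen
                (θ.sigma (k.castLE (atyp_le_left n m lam)))))
            * exponentRow (shiftedPart m mu.rowLen) ((θ.A k).toNat : ℤ)
              (θ.tau (k.castLE (atyp_le_right n m lam)))) := by
  have hsign : HahnSeries.C θ.sign = ((Equiv.Perm.sign θ.sigma : ℤ) : LaurentSeries ℚ)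
      * ((Equiv.Perm.sign θ.tau : ℤ) : LaurentSeries ℚ)
      * ∏ k, ((-1) ^ (θ.A k) : LaurentSeries ℚ) := by
    have h : (-1 : ℚ) ^ (∑ i, θ.A i) = ∏ i, (-1) ^ θ.A i := by
      induction (Finset.univ : Finset (Fin (atyp n m lam))) using Finset.induction_on with
      | empty => simp
      | insert a s ha ih =>
        rw [Finset.sum_insert ha, Finset.prod_insert ha, zpow_add₀ (by norm_num), ih]
    rw [Theta.sign, h, map_mul, map_mul, map_intCast, map_intCast, map_prod]
    congr 1
    refine Finset.prod_congr rfl fun k _ => ?_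
    rw [map_zpow₀, map_neg, map_one]
  have hexp : qpow (θ.Delta mu nu)
      = qpow (∑ k : Fin (n - atyp n m lam), (P n m lam k + 1) * N n nu k)
      * qpow (∑ k : Fin (m - atyp n m lam), Q n m lam k * M m mu k)
      * (∏ k : Fin (n - atyp n m lam), exponentRow (shiftedPart n nu.rowLen) (P n m lam k + 1)
          (θ.sigma ⟨atyp n m lam + k, Nat.add_lt_of_lt_sub' k.isLt⟩))
      * (∏ k : Fin (m - atyp n m lam), exponentRow (shiftedPart m mu.rowLen) (Q n m lam k)
          (θ.tau ⟨atyp n m lam + k, Nat.add_lt_of_lt_sub' k.isLt⟩))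
      * ∏ k : Fin (atyp n m lam), (qpow (θ.A k * (θ.A k + 1) / 2
              + θ.A k * shiftedPart n nu.rowLen (θ.sigma (k.castLE (atyp_le_left n m lam))))
            * exponentRow (shiftedPart m mu.rowLen) (θ.A k)
              (θ.tau (k.castLE (atyp_le_right n m lam)))) := by
    simp only [exponentRow, ← qpow_add, ← qpow_sum]
    congr 1
    simp only [Theta.Delta, N_eq, M_eq, mul_sub, Finset.sum_sub_distrib, Finset.sum_add_distrib,
      neg_mul, Finset.sum_neg_distrib]
    ring
  rw [Theta.term, hsign, hexp, bosonicFactor]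
  simp only [θ.toNat_A hlam, Finset.prod_mul_distrib, div_eq_mul_inv, inv_pow]
  ring

/-- The theta exponent is split so that the sign, the quadratic part and `A N` go to the `σ` side,
leaving the pure row `q^{-A M}` on the `τ` side. That row coincides with a bottom row exactly when
`A = Q_j`, as the cancellation requires. -/
theorem hasSum_term (hlam : lam.rowLen n < m + 1) :
    HasSum (fun θ : Theta n m lam => θ.term mu nu)
      (bosonicFactor n m mu nu lam * (((atyp n m lam).factorial : LaurentSeries ℚ)⁻¹
        * borderedPairing (atyp_le_left n m lam) (atyp_le_right n m lam)
          (fun k => exponentRow (shiftedPart n nu.rowLen) (P n m lam k + 1))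
          (fun k => exponentRow (shiftedPart m mu.rowLen) (Q n m lam k))
          (fun l l' => partialTheta
            ((shiftedPart n nu.rowLen l : ℤ) - shiftedPart m mu.rowLen l')))) := by
  have h := hasSum_borderedPairing_expand (atyp_le_left n m lam) (atyp_le_right n m lam)
    (f := fun A l => (-1) ^ (A : ℤ)
      * qpow ((A : ℤ) * (A + 1) / 2 + A * shiftedPart n nu.rowLen l))
    (g := fun A => exponentRow (shiftedPart m mu.rowLen) A)
    (H := fun l l' => partialTheta ((shiftedPart n nu.rowLen l : ℤ) - shiftedPart m mu.rowLen l'))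
    (fun l l' => by
      refine (congrArg (fun f => HasSum f _) (funext fun A => ?_)).mpr (summable_theta _).hasSum
      rw [exponentRow, mul_assoc, ← qpow_add]
      congr 2
      ring)
    (fun k => exponentRow (shiftedPart n nu.rowLen) (P n m lam k + 1))
    (fun k => exponentRow (shiftedPart m mu.rowLen) (Q n m lam k))
    (p := fun A => ∀ k, ∀ j : Fin (m - atyp n m lam), (A k : ℤ) ≠ Q n m lam j)
    (fun x hx => by
      simp only [not_forall, not_not] at hx
      obtain ⟨k, j, hkj⟩ := hx
      exact ⟨k, j, by rw [hkj]⟩)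
  have h1 := ((thetaEquiv hlam).hasSum_iff.2 h).mul_left (bosonicFactor n m mu nu lam)
  exact (congrArg (fun f => HasSum f _) (funext fun θ => θ.term_eq hlam)).mpr h1

/-- The diagonal sum is evaluated by Cauchy-Binet and the hook identity. The rows at infinity give
`(q)_∞^{-(n-r)-(m-r)}` and the `r` hooks give `(q)_∞^{-2r}`, in total `(q)_∞^{-(n+m)}`. -/
theorem chi_eq (hnu : nu.colLen 0 ≤ n) (hmu : mu.colLen 0 ≤ m) (hlam : lam.rowLen n < m + 1) :
    chi n m mu nu lam = (-1) ^ (atyp n m lam * (m + n)) *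
      (bosonicFactor n m mu nu lam * (((atyp n m lam).factorial : LaurentSeries ℚ)⁻¹
        * borderedPairing (atyp_le_left n m lam) (atyp_le_right n m lam)
          (fun k => exponentRow (shiftedPart n nu.rowLen) (P n m lam k + 1))
          (fun k => exponentRow (shiftedPart m mu.rowLen) (Q n m lam k))
          (fun l l' => partialTheta
            ((shiftedPart n nu.rowLen l : ℤ) - shiftedPart m mu.rowLen l')))) := by
  have hn := atyp_le_left n m lam
  have hm := atyp_le_right n m lam
  have h1 := hasSum_chi_diagonal hnu hmu hlam
  have h2 := hasSum_det_bordered_mul hn hm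
    (fun l l' => hasSum_hook (shiftedPart n nu.rowLen l) (shiftedPart m mu.rowLen l'))
    (fun k => exponentRow (shiftedPart n nu.rowLen) (P n m lam k + 1))
    (fun k => exponentRow (shiftedPart m mu.rowLen) (Q n m lam k))
  rw [borderedPairing_mul hn hm] at h2
  have h3 := h2.mul_left ((-1) ^ (atyp n m lam * (n - 1)) * (-1) ^ (atyp n m lam * (m - 1))
    * qpow (∑ k : Fin (n - atyp n m lam), (P n m lam k + 1) * N n nu k)
    * qpow (∑ k : Fin (m - atyp n m lam), Q n m lam k * M m mu k)
    * qInf⁻¹ ^ (n - atyp n m lam) * qInf⁻¹ ^ (m - atyp n m lam))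
  have h4 : ∀ k : Fin (n - atyp n m lam), N n nu k = shiftedPart n nu.rowLen ⟨k, by omega⟩ :=
    fun k => N_eq nu ⟨k, by omega⟩
  have h5 : ∀ k : Fin (m - atyp n m lam), M m mu k = shiftedPart m mu.rowLen ⟨k, by omega⟩ :=
    fun k => M_eq mu ⟨k, by omega⟩
  have h6 := h1.unique ((congrArg (fun f => HasSum f _) (funext fun x => ?_)).mpr h3)
  · rw [h6, bosonicFactor]
    have hq : qInf⁻¹ ^ (n - atyp n m lam) * qInf⁻¹ ^ (m - atyp n m lam)
        * (qInf⁻¹ * qInf⁻¹) ^ atyp n m lam = qInf⁻¹ ^ (n + m) := by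
      rw [mul_pow, ← pow_add, ← pow_add, ← pow_add]
      congr 1
      omega
    have hs : ((-1) ^ (atyp n m lam * (n - 1)) * (-1) ^ (atyp n m lam * (m - 1)) :
        LaurentSeries ℚ) = (-1) ^ (atyp n m lam * (m + n)) := by
      -- For `r > 0` both `n` and `m` are positive, so `n - 1` and `m - 1` are not truncated and the
      -- exponents differ by `2r`.
      rcases Nat.eq_zero_or_pos (atyp n m lam) with h0 | h0
      · simp [h0]
      · obtain ⟨a, ha⟩ := Nat.exists_eq_add_of_le' (h0.trans_le hn)
        obtain ⟨b, hb⟩ := Nat.exists_eq_add_of_le' (h0.trans_le hm)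
        rw [← pow_add, show atyp n m lam * (m + n)
          = (atyp n m lam * (n - 1) + atyp n m lam * (m - 1)) + 2 * atyp n m lam by
            zify [h0.trans_le hn, h0.trans_le hm]; ring,
          pow_add (-1 : LaurentSeries ℚ) _ (2 * _), pow_mul, neg_one_sq, one_pow, mul_one]
    rw [← hq, ← hs]
    unfold partialTheta
    ring
  · rw [qpow_excessInt_mul_pathDet_fillTop hn (birth_rowLen_eq_zero_iff n m lam),
      pathDet_fillTop hm (birth_colLen_eq_zero_iff n m lam)]
    simp only [← P_add_one_eq, ← Q_eq, ← h4, ← h5]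
    ring

end ThetaSum

end PitPartition

/-- Lengths `ℓ(ν) ≤ n` and `ℓ(μ) ≤ m` are `nu.colLen 0 ≤ n` and `mu.colLen 0 ≤ m`; the condition
`λ_{n+1} < m + 1` is `lam.rowLen n < m + 1`. The first conjunct says that `chi` is the formal sum of
`q^{|a|}`, the second one is the bosonic formula. -/
theorem theorem3 (n m : ℕ) (mu nu lam : YoungDiagram)
    (hnu : nu.colLen 0 ≤ n) (hmu : mu.colLen 0 ≤ m) (hlam : lam.rowLen n < m + 1) :
    PitPartition.HasFormalSum
        (fun a : PitPartition.PlanePartition n m mu nu lam => PitPartition.qpow a.weight)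
        (PitPartition.chi n m mu nu lam) ∧
      ∃ S : LaurentSeries ℚ,
        PitPartition.HasFormalSum
            (fun θ : PitPartition.Theta n m lam => θ.term mu nu) S ∧
          PitPartition.chi n m mu nu lam
            = (-1) ^ (PitPartition.atyp n m lam * (m + n)) * S := by
  exact ⟨PitPartition.hasFormalSum_of_hasSum (PitPartition.hasSum_chi hnu hmu hlam), _,
    PitPartition.hasFormalSum_of_hasSum (PitPartition.hasSum_term hlam),
    PitPartition.chi_eq hnu hmu hlam⟩
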